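/- Let $\Omega\subset\mathbb R^2$ be convex with non-empty interior, and let $\varphi:\Omega\to\mathbb R_{\ge 0}$ satisfy $\int_\Omega\varphi=1$ with $\mathcal Q=\{q\in\Omega:\varphi(q)>0\}$ bounded and convex. For each $\lambda>0$, service requests are generated by a spatio-temporal Poisson point process with temporal intensity $\lambda$ and spatial density $\varphi$: the numbers of requests in disjoint time-space regions are independent, and the number generated in $[s,s+t)$ at points of $S$ is Poisson with mean $\lambda t\int_{S\cap\Omega}\varphi$. The requests are labelled in order of generation, the $j$-th at time $t_j$ with target $e_j\in\Omega$ ($j=0,1,2,\dots$); the process for intensity $\lambda$ lives on its own probability space, with probability $P_\lambda$. There are $m\ge 1$ agents with positions $p_i(t)\in\Omega$, fixed initial positions (independent of $\lambda$) and speed at most $1$. A request is serviced at the first time, from its generation on, at which an agent is at its target, and is credited to one such agent. Let $\mathcal B_i(t)$ be the set of targets generated in $[0,t)$ and serviced by agent $i$ up to time $t$, and let the demand queue $\mathcal D(t)$ be the set of targets generated in $[0,t)$ and not serviced up to time $t$. The reference point $p_i^*(t)$ of agent $i$ is the minimizer of $q\mapsto\sum_{e\in\mathcal B_i(t)}\|e-q\|$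 over $q\in\Omega$ nearest to $p_i(t)$ (so $p_i^*(t)=p_i(t)$ if $\mathcal B_i(t)=\emptyset$). Agents solve, for almost every $t\ge0$, $$\dot p_i=\mathrm{vers}(F_i-p_i),\qquad \mathrm{vers}(v)=v/\|v\|\ (v\neq0),\quad \mathrm{vers}(0)=0,$$ where $F_i$ is given by one of the following policies (ties between nearest targets are broken arbitrarily). * No-communication policy: $F_i$ is the point of $\mathcal D(t)$ nearest to $p_i$ if $\mathcal D(t)\ne\emptyset$, and $F_i=p_i^*(t)$ otherwise. * Sensor-based policy: let $\mathcal V_i=\{q\in\Omega:\|q-p_i\|\le\|q-p_j\|\ \forall j\}$. If $\mathcal B_i(t)\neq\emptyset$, then $F_i$ is the point of $\mathcal D(t)\cap\mathcal V_i$ nearest to $p_i$ if this set is non-empty, and $F_i=p_i^*(t)$ otherwise. If $\mathcal B_i(t)=\emptyset$, agent $i$ follows either (a) the no-communication rule, or (b) the rule: $F_i$ is the point of $\mathcal D(t)$ nearest to $p_i$ if $\mathcal D(t)\cap\mathcal V_i\ne\emptyset$, and $F_i=p_i^*(t)=p_i$ otherwise. The result is asserted for both versions. Then, for each of these policies: 1.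 With high probability as $\lambda\to0^+$, all agents return to their reference points before the next service request is generated, infinitely often. Precisely, call $j$ a *return index* if there is $s\in(t_j,t_{j+1})$ such that for all $t\in[s,t_{j+1}]$ one has $\mathcal D(t)=\emptyset$ and $p_i(t)=p_i^*(t)$ for every $i$. The probability $P_\lambda$ that there is an agent trajectory with only finitely many return indices tends to $0$ as $\lambda\to0^+$. 2. With high probability as $\lambda\to0^+$, targets are generated while all agents wait at their reference points with an empty demand queue, after an initial transient of any length, and in fact uniformly over all transients. Precisely, for every $N\in\mathbb N$, $$\lim_{\lambda\to0^+}\ \sup_{k\ge0}\ P_\lambda\Big[\text{for some agent trajectory and some } j\in\{k,\dots,k+N-1\}:\ \mathcal D(t_j)\ne\emptyset\ \text{ or }\ p_i(t_j)\neq p_i^*(t_j)\text{ for some } i\Big]=0 .$$ (Probabilities of these exceptional events are understood as outer probabilities.) -/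

import Mathlib

open MeasureTheory ProbabilityTheory Set Filter Topology

namespace LightLoad

/-- The Euclidean plane. -/
abbrev Plane := EuclideanSpace ℝ (Fin 2)

/-- A realization of the stream of service requests, labelled in order of generation:
`time j` is the generation time of the `j`-th request and `loc j` its target point. -/
structure Requests where
  time : ℕ → ℝ
  loc : ℕ → Plane

/-- The number of requests of a realization in a time-space region. -/
noncomputable def Requests.count (r : Requests) (A : Set (ℝ × Plane)) : ℕ∞ :=
  {j | (r.time j, r.loc j) ∈ A}.encard

/-- `R` is a spatio-temporal Poisson point process on the workspace `W` with temporal intensity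
`lam` and spatial density `φ`: the numbers of events in disjoint time-space regions are
independent, and the number of events in `[s, s + t) × S` is Poisson distributed with mean
`lam * t * φ(S)`, where `φ(S)` is the integral of `φ` over the part of `S` in `W`. -/
structure IsPoissonRequestProcess {S₀ : Type*} [MeasurableSpace S₀] (μ : Measure S₀)
    (W : Set Plane) (φ : Plane → ℝ) (lam : ℝ) (R : S₀ → Requests) : Prop where
  measurable_time : ∀ j, Measurable fun ω => (R ω).time j
  measurable_loc : ∀ j, Measurable fun ω => (R ω).loc j
  time_nonneg : ∀ ω j, 0 ≤ (R ω).time j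
  time_mono : ∀ ω, Monotone (R ω).time
  loc_mem : ∀ ω j, (R ω).loc j ∈ W
  indep : ∀ (n : ℕ) (A : Fin n → Set (ℝ × Plane)), (∀ k, MeasurableSet (A k)) →
    Pairwise (fun k l => Disjoint (A k) (A l)) →
    iIndepFun (fun k ω => (R ω).count (A k)) μ
  law : ∀ (s t : ℝ) (S : Set Plane) (k : ℕ), 0 ≤ s → 0 ≤ t → MeasurableSet S →
    μ {ω | (R ω).count (Ico s (s + t) ×ˢ S) = (k : ℕ∞)} =
      ENNReal.ofReal (Real.exp (-(lam * t * ∫ q in S ∩ W, φ q)) *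
        (lam * t * ∫ q in S ∩ W, φ q) ^ k / (k.factorial : ℝ))

/-- The motion of `m` agents: `pos i t` is the position of agent `i` at time `t`; `server j` is
the agent to which the service of the `j`-th request is credited, if that request is serviced
(this matters only when several agents arrive at the target simultaneously). -/
structure Motion (m : ℕ) where
  pos : Fin m → ℝ → Plane
  server : ℕ → Fin m

variable {m : ℕ}

/-- The times, from its generation on, at which some agent is at the `j`-th target. The request is
fulfilled at the first of them. -/
def visits (r : Requests) (x : Motion m) (j : ℕ) : Set ℝ :=
  {s | r.time j ≤ s ∧ ∃ i, x.pos i s = r.loc j}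

/-- `𝓑ᵢ(t)`: (labels of) the requests generated in `[0, t)` and serviced by agent `i` up to
time `t`. -/
def serviced (r : Requests) (x : Motion m) (i : Fin m) (t : ℝ) : Set ℕ :=
  {j | r.time j < t ∧ x.server j = i ∧ ∃ s ≤ t, IsLeast (visits r x j) s}

/-- `𝓓(t)`: (labels of) the requests generated in `[0, t)` and not serviced up to time `t`. -/
def demand (r : Requests) (x : Motion m) (t : ℝ) : Set ℕ :=
  {j | r.time j < t ∧ ∀ s ∈ visits r x j, t < s}

/-- The points of `S` nearest to `y`. -/
def nearest (S : Set Plane) (y : Plane) : Set Plane :=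
  {q ∈ S | ∀ q' ∈ S, dist y q ≤ dist y q'}

/-- The discrete Weber function of the targets with labels in `B` (zero if `B` is empty). -/
noncomputable def weber (r : Requests) (B : Set ℕ) (q : Plane) : ℝ :=
  ∑ᶠ j ∈ B, ‖r.loc j - q‖

/-- The reference point of an agent at `y` which has serviced the targets with labels in `B`:
the minimizer over `W` of the Weber function that is nearest to `y`. -/
def referencePoint (W : Set Plane) (r : Requests) (B : Set ℕ) (y : Plane) : Set Plane :=
  nearest {q | q ∈ W ∧ ∀ q' ∈ W, weber r B q ≤ weber r B q'} y

/-- The Voronoi cell of agent `i` in `W`, for agents at `y`. -/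
def voronoi (W : Set Plane) (y : Fin m → Plane) (i : Fin m) : Set Plane :=
  {q ∈ W | ∀ j, dist q (y i) ≤ dist q (y j)}

/-- The control policies. `noComm` is the no-communication policy. `sensor` and `sensorGated`
are the sensor-based policy; they differ only for an agent that has not serviced any target yet:
under `sensor` it follows the no-communication policy, under `sensorGated` it does so only while
there is an outstanding target in its Voronoi cell, and else stays where it is. -/
inductive Policy
  | noComm
  | sensor
  | sensorGated

open Classical in
/-- The points towards which the policy may steer agent `i`, when the agents are at `y`, the
outstanding targets are the points of `D`, and agent `i` has serviced the targets with labels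
in `B`. There is more than one such point only when there are several nearest targets. -/
noncomputable def aim (W : Set Plane) (r : Requests) (y : Fin m → Plane) (i : Fin m)
    (B : Set ℕ) (D : Set Plane) : Policy → Set Plane
  | .noComm => if D.Nonempty then nearest D (y i) else referencePoint W r B (y i)
  | .sensor =>
      if B = ∅ then
        if D.Nonempty then nearest D (y i) else referencePoint W r B (y i)
      else if (D ∩ voronoi W y i).Nonempty then nearest (D ∩ voronoi W y i) (y i)
      else referencePoint W r B (y i)
  | .sensorGated =>
      if (D ∩ voronoi W y i).Nonempty then
        if B = ∅ then nearest D (y i) else nearest (D ∩ voronoi W y i) (y i)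
      else referencePoint W r B (y i)

/-- The unit vector in the direction of `v`, and `0` if `v = 0`. -/
noncomputable def vers (v : Plane) : Plane := ‖v‖⁻¹ • v

/-- `x` is a closed-loop trajectory of the agents under the policy `π`, from the initial positions
`y₀`, for the request realization `r`: the agents remain in the workspace and move with at most
unit speed, they solve `dpᵢ/dt = vers (Fᵢ - pᵢ)` for almost every `t ≥ 0`, with `Fᵢ` the point
chosen by the policy, and each serviced request is credited to an agent that is at the target at
the service time. -/
structure IsTrajectory (π : Policy) (W : Set Plane) (y₀ : Fin m → Plane) (r : Requests)
    (x : Motion m) : Prop where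
  init : ∀ i, x.pos i 0 = y₀ i
  mem : ∀ i, ∀ t, 0 ≤ t → x.pos i t ∈ W
  speed : ∀ i, LipschitzOnWith 1 (x.pos i) (Ici 0)
  dynamics : ∀ᵐ t ∂(volume.restrict (Ici (0 : ℝ))), ∀ i,
    ∃ q ∈ aim W r (fun k => x.pos k t) i (serviced r x i t) (r.loc '' demand r x t) π,
      HasDerivAt (x.pos i) (vers (q - x.pos i t)) t
  server_mem : ∀ j s, IsLeast (visits r x j) s → x.pos (x.server j) s = r.loc j

/-- Agent `i` is at its reference point at time `t`. -/
def AtReference (W : Set Plane) (r : Requests) (x : Motion m) (i : Fin m) (t : ℝ) : Prop :=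
  x.pos i t ∈ referencePoint W r (serviced r x i t) (x.pos i t)

/-- At time `t` the demand queue is empty and all agents are at their reference points. At
`t = r.time j`, the queue does not yet contain the request generated at that instant. -/
def AllWaiting (W : Set Plane) (r : Requests) (x : Motion m) (t : ℝ) : Prop :=
  demand r x t = ∅ ∧ ∀ i, AtReference W r x i t

/-- Between the generation of requests `j` and `j + 1` every agent gets (back) to its reference
point, with the queue empty, and waits there until request `j + 1` is generated. -/
def AllReturn (W : Set Plane) (r : Requests) (x : Motion m) (j : ℕ) : Prop :=
  ∃ s ∈ Ioo (r.time j) (r.time (j + 1)), ∀ t ∈ Icc s (r.time (j + 1)), AllWaiting W r x t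

end LightLoad

namespace LightLoad

/-! ### Lipschitz functions with a one-sided bound on the derivative -/

/-! The argument splits into a deterministic criterion and a Poisson estimate uniform in the request
index.

Targets (almost surely) and agents stay in a ball of radius `ρ`. Under every policy, the agent of a
closest agent-target pair steers to an outstanding target that is no farther away, so the smallest
such distance shrinks at unit rate until some target is reached. Hence `backlog` with constant `2ρ`
dominates the clearing time: it falls at unit rate while the queue is non-empty and gains at most
`2ρ` per request, like the workload of a queue with deterministic service (`backlog_le_sub`,
`backlog_succ_le`, `exists_backlog_le`). With the queue empty, the sets of Weber minimizers are
frozen and every agent reaches its own within `2ρ`. So all agents return before request `J` unless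
`EndsCluster (4ρ) r J` holds (`allReturn_of_not_endsCluster`).

A cluster forces `M ≥ 2` requests into `M` cells of a grid of mesh `C`, which has probability at
most `(eλC)^M`. Summing over where the cluster starts costs a factor of order `1/(λC)`, and since `M
≥ 2` a bound of order `λC` remains for every `J` (`measure_endsCluster_le`). The second claim is
then a union bound. For the first, finitely many returns make all late indices end clusters, an
increasing union of events each bounded by that of a single index. -/

theorem le_sub_of_ae_hasDerivAt_le {f : ℝ → ℝ} {K : NNReal} {a b v : ℝ} (hab : a ≤ b)
    (hf : LipschitzOnWith K f (Icc a b))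
    (h : ∀ᵐ t : ℝ, t ∈ Ioo a b → ∀ d, HasDerivAt f d t → d ≤ -v) :
    f b ≤ f a - v * (b - a) := by
  have hac : AbsolutelyContinuousOnInterval f a b :=
    LipschitzOnWith.absolutelyContinuousOnInterval (K := K) (by rwa [uIcc_of_le hab])
  have hdiff := hf.ae_differentiableWithinAt_of_mem_real
  have hae : ∀ᵐ t ∂(volume.restrict (Icc a b)), deriv f t ≤ -v := by
    rw [← restrict_Ioo_eq_restrict_Icc, ae_restrict_iff' measurableSet_Ioo]
    filter_upwards [h, hdiff] with t ht hd hm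
    have hd' : DifferentiableAt ℝ f t :=
      (hd (Ioo_subset_Icc_self hm)).differentiableAt (Icc_mem_nhds hm.1 hm.2)
    exact ht hm _ hd'.hasDerivAt
  have hint := intervalIntegral.integral_mono_ae_restrict hab hac.intervalIntegrable_deriv
    (intervalIntegrable_const (c := -v)) hae
  rw [hac.integral_deriv_eq_sub, intervalIntegral.integral_const, smul_eq_mul] at hint
  linarith

theorem antitoneOn_of_ae_hasDerivAt_nonpos {f : ℝ → ℝ} {K : NNReal} {a b : ℝ}
    (hf : LipschitzOnWith K f (Icc a b))
    (h : ∀ᵐ t : ℝ, t ∈ Ioo a b → ∀ d, HasDerivAt f d t → d ≤ 0) :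
    AntitoneOn f (Icc a b) := by
  intro s hs t ht hst
  have := le_sub_of_ae_hasDerivAt_le (v := 0) hst (hf.mono (Icc_subset_Icc hs.1 ht.2)) (by
    filter_upwards [h] with u hu hm
    simpa using hu ⟨hs.1.trans_lt hm.1, hm.2.trans_le ht.2⟩)
  linarith

/-- A nonnegative Lipschitz function decreasing at unit rate where it is positive. -/
theorem le_max_of_ae_hasDerivAt_le_neg_one {g : ℝ → ℝ} {K : NNReal} {a b : ℝ} (hab : a ≤ b)
    (hg : LipschitzOnWith K g (Icc a b)) (h0 : ∀ t, 0 ≤ g t)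
    (h : ∀ᵐ t : ℝ, t ∈ Ioo a b → 0 < g t → ∀ d, HasDerivAt g d t → d ≤ -1) :
    g b ≤ max (g a - (b - a)) 0 := by
  have hanti : AntitoneOn g (Icc a b) := antitoneOn_of_ae_hasDerivAt_nonpos hg (by
    filter_upwards [h] with t ht hm d hd
    rcases (h0 t).eq_or_lt with h1 | h1
    · refine (IsLocalMin.hasDerivAt_eq_zero (Eventually.of_forall fun s => ?_) hd).le
      rw [← h1]; exact h0 s
    · linarith [ht hm h1 d hd])
  rcases (h0 b).eq_or_lt with h1 | h1
  · rw [← h1]; exact le_max_right _ _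
  · refine le_max_of_le_left ?_
    have := le_sub_of_ae_hasDerivAt_le (v := 1) hab hg (by
      filter_upwards [h] with t ht hm d hd
      exact ht hm (h1.trans_le
        (hanti (Ioo_subset_Icc_self hm) (right_mem_Icc.2 hab) hm.2.le)) d hd)
    linarith

/-- Differentiates a minimum of distances: where the minimum is differentiable, its derivative is
that of any distance attaining it, so no minimizer has to be selected along time. -/
theorem hasDerivAt_unique_of_le {f g : ℝ → ℝ} {t d e : ℝ} (hle : ∀ s, g s ≤ f s)
    (heq : g t = f t) (hf : HasDerivAt f e t) (hg : HasDerivAt g d t) : d = e := by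
  have := IsLocalMin.hasDerivAt_eq_zero (f := fun s => f s - g s) (a := t)
    (Eventually.of_forall fun s => by simp only [heq, sub_self]; linarith [hle s]) (hf.sub hg)
  linarith

theorem hasDerivAt_dist_const {p : ℝ → Plane} {v z : Plane} {t : ℝ} (hp : HasDerivAt p v t)
    (hz : 0 < dist (p t) z) :
    HasDerivAt (fun s => dist (p s) z) (inner ℝ (p t - z) v / dist (p t) z) t := by
  have h1 := (hp.sub_const z).norm_sq.sqrt (by
    rw [dist_eq_norm] at hz; positivity)
  have h2 : (fun s => √(‖p s - z‖ ^ 2)) = fun s => dist (p s) z := by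
    funext s; rw [Real.sqrt_sq (norm_nonneg _), dist_eq_norm]
  rw [h2] at h1
  convert h1 using 1
  rw [Real.sqrt_sq (norm_nonneg _), dist_eq_norm, mul_div_mul_left _ _ two_ne_zero]

theorem hasDerivAt_dist_of_vers {p : ℝ → Plane} {q : Plane} {t : ℝ}
    (hp : HasDerivAt p (vers (q - p t)) t) (hq : 0 < dist (p t) q) :
    HasDerivAt (fun s => dist (p s) q) (-1) t := by
  convert hasDerivAt_dist_const hp hq using 1
  rw [dist_eq_norm] at hq ⊢
  rw [vers, inner_smul_right, ← neg_sub (p t) q, inner_neg_right, real_inner_self_eq_norm_sq,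
    norm_neg]
  field_simp

theorem lipschitzOnWith_dist_const {p : ℝ → Plane} {s : Set ℝ} (hp : LipschitzOnWith 1 p s)
    (z : Plane) : LipschitzOnWith 1 (fun t => dist (p t) z) s := by
  refine LipschitzOnWith.of_dist_le_mul fun a ha b hb => ?_
  exact (dist_dist_dist_le_left (p a) (p b) z).trans (hp.dist_le_mul a ha b hb)

/-! ### Weber points -/

/-- The minimizers of the Weber function over the workspace. -/
def weberPoints (W : Set Plane) (r : Requests) (B : Set ℕ) : Set Plane :=
  {q | q ∈ W ∧ ∀ q' ∈ W, weber r B q ≤ weber r B q'}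

theorem weberPoints_empty (W : Set Plane) (r : Requests) : weberPoints W r ∅ = W := by
  simp [weberPoints, weber]

/-- Take the projection `p` of `q` on the hull: the angle at `p` between `q` and any point of the
hull is not acute, so moving from `q` to `p` gets strictly closer to all of `s`. -/
theorem exists_mem_convexHull_dist_lt {s : Set Plane} (hs : s.Finite) (hne : s.Nonempty)
    {q : Plane} (hq : q ∉ convexHull ℝ s) :
    ∃ p ∈ convexHull ℝ s, ∀ e ∈ s, ‖e - p‖ < ‖e - q‖ := by
  obtain ⟨p, hp, hpq⟩ := exists_norm_eq_iInf_of_complete_convex (hne.convexHull (𝕜 := ℝ))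
    (hs.isCompact_convexHull ℝ).isComplete (convex_convexHull ℝ s) q
  have hin := (norm_eq_iInf_iff_real_inner_le_zero (convex_convexHull ℝ s) hp).1 hpq
  refine ⟨p, hp, fun e he => ?_⟩
  have h1 := hin e (subset_convexHull ℝ s he)
  have h2 : 0 < ‖q - p‖ := norm_pos_iff.2 (sub_ne_zero.2 fun h => hq (h ▸ hp))
  have h3 : ‖e - q‖ ^ 2 = ‖e - p‖ ^ 2 - 2 * inner ℝ (q - p) (e - p) + ‖q - p‖ ^ 2 := by
    rw [show e - q = (e - p) - (q - p) by abel, norm_sub_sq_real, real_inner_comm]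
  refine lt_of_pow_lt_pow_left₀ 2 (norm_nonneg _) ?_
  nlinarith [pow_pos h2 2]

theorem weber_eq_sum (r : Requests) {B : Set ℕ} (hB : B.Finite) (q : Plane) :
    weber r B q = ∑ j ∈ hB.toFinset, ‖r.loc j - q‖ :=
  finsum_mem_eq_finite_toFinset_sum _ hB

theorem continuous_weber (r : Requests) {B : Set ℕ} (hB : B.Finite) :
    Continuous (weber r B) := by
  simp_rw [funext fun q => weber_eq_sum r hB q]
  fun_prop

theorem exists_mem_convexHull_weber_lt (r : Requests) {B : Set ℕ} (hB : B.Finite)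
    (hne : B.Nonempty) {q : Plane} (hq : q ∉ convexHull ℝ (r.loc '' B)) :
    ∃ p ∈ convexHull ℝ (r.loc '' B), weber r B p < weber r B q := by
  obtain ⟨p, hp, h⟩ := exists_mem_convexHull_dist_lt (hB.image r.loc) (hne.image _) hq
  refine ⟨p, hp, ?_⟩
  rw [weber_eq_sum r hB, weber_eq_sum r hB]
  exact Finset.sum_lt_sum_of_nonempty (by simpa using hne)
    fun j hj => h _ (mem_image_of_mem _ (by simpa using hj))

section Weber

variable {W : Set Plane} {r : Requests} {B : Set ℕ} (hW : Convex ℝ W) (hloc : ∀ j, r.loc j ∈ W)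
  (hB : B.Finite) (hne : B.Nonempty)

include hW hloc hB hne

theorem weberPoints_subset : weberPoints W r B ⊆ convexHull ℝ (r.loc '' B) := by
  intro q hq
  by_contra h
  obtain ⟨p, hp, hlt⟩ := exists_mem_convexHull_weber_lt r hB hne h
  have : p ∈ W := convexHull_min (by rintro _ ⟨j, -, rfl⟩; exact hloc j) hW hp
  exact absurd (hq.2 p this) (not_le.2 hlt)

/-- `W` need be neither closed nor bounded; compactness comes from the hull of finitely many
targets, which lies in `W` and contains all minimizers. -/
theorem isCompact_weberPoints : IsCompact (weberPoints W r B) := by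
  have hHW : convexHull ℝ (r.loc '' B) ⊆ W :=
    convexHull_min (by rintro _ ⟨j, -, rfl⟩; exact hloc j) hW
  have : weberPoints W r B =
      convexHull ℝ (r.loc '' B) ∩ ⋂ q' ∈ W, {q | weber r B q ≤ weber r B q'} := by
    ext q
    simp only [mem_inter_iff, mem_iInter, mem_ofPred_eq]
    exact ⟨fun h => ⟨weberPoints_subset hW hloc hB hne h, h.2⟩, fun h => ⟨hHW h.1, h.2⟩⟩
  rw [this]
  refine ((hB.image _).isCompact_convexHull ℝ).inter_right ?_
  exact isClosed_biInter fun q' _ => isClosed_le (continuous_weber r hB) continuous_const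

theorem weberPoints_nonempty : (weberPoints W r B).Nonempty := by
  have hHW : convexHull ℝ (r.loc '' B) ⊆ W :=
    convexHull_min (by rintro _ ⟨j, -, rfl⟩; exact hloc j) hW
  obtain ⟨p, hp, hmin⟩ := ((hB.image r.loc).isCompact_convexHull ℝ).exists_isMinOn
    ((hne.image r.loc).convexHull (𝕜 := ℝ)) (continuous_weber r hB).continuousOn
  refine ⟨p, hHW hp, fun q' _ => ?_⟩
  by_cases h : q' ∈ convexHull ℝ (r.loc '' B)
  · exact hmin h
  · obtain ⟨p', hp', hlt⟩ := exists_mem_convexHull_weber_lt r hB hne h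
    exact (hmin hp').trans hlt.le

end Weber

theorem mem_nearest_self {S : Set Plane} {y : Plane} : y ∈ nearest S y ↔ y ∈ S :=
  ⟨fun h => h.1, fun h => ⟨h, fun q' _ => by simp [dist_nonneg]⟩⟩

theorem infDist_eq_of_mem_nearest {S : Set Plane} {y q : Plane} (h : q ∈ nearest S y) :
    Metric.infDist y S = dist y q :=
  le_antisymm (Metric.infDist_le_dist_of_mem h.1)
    ((Metric.le_infDist ⟨q, h.1⟩).2 fun {q'} hq' => h.2 q' hq')

/-! ### The points at which the policies aim -/

variable {m : ℕ}

theorem aim_empty (W : Set Plane) (r : Requests) (y : Fin m → Plane) (i : Fin m) (B : Set ℕ)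
    (π : Policy) : aim W r y i B ∅ π = referencePoint W r B (y i) := by
  cases π <;> simp [aim]

theorem mem_or_mem_referencePoint_of_mem_aim {W : Set Plane} {r : Requests} {y : Fin m → Plane}
    {i : Fin m} {B : Set ℕ} {D : Set Plane} {π : Policy} {q : Plane}
    (hq : q ∈ aim W r y i B D π) : q ∈ D ∨ q ∈ referencePoint W r B (y i) := by
  cases π <;> simp only [aim] at hq <;> split_ifs at hq <;>
    first | exact Or.inr hq | exact Or.inl hq.1 | exact Or.inl hq.1.1

/-- The agent closest to an outstanding target steers, under every policy, towards an outstanding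
target that is at most as far. -/
theorem mem_and_dist_le_of_mem_aim {W : Set Plane} {r : Requests} {y : Fin m → Plane}
    {i : Fin m} {B : Set ℕ} {D : Set Plane} {π : Policy} {q e : Plane}
    (hq : q ∈ aim W r y i B D π) (he : e ∈ D) (heW : e ∈ W)
    (hclose : ∀ j, dist e (y i) ≤ dist e (y j)) :
    q ∈ D ∧ dist (y i) q ≤ dist (y i) e := by
  -- Being the closest agent puts `e` in the cell of `i`, so no policy can fall back on the
  -- reference point.
  have hV : e ∈ D ∩ voronoi W y i := ⟨he, heW, hclose⟩
  have hDV : (D ∩ voronoi W y i).Nonempty := ⟨e, hV⟩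
  have hD : D.Nonempty := ⟨e, he⟩
  cases π <;> simp only [aim, hD, hDV, if_true] at hq
  · exact ⟨hq.1, hq.2 e he⟩
  · split_ifs at hq
    · exact ⟨hq.1, hq.2 e he⟩
    · exact ⟨hq.1.1, hq.2 e hV⟩
  · split_ifs at hq
    · exact ⟨hq.1, hq.2 e he⟩
    · exact ⟨hq.1.1, hq.2 e hV⟩

/-! ### Trajectories between two successive requests -/

/-- The requests are ordered in time, and their targets lie in the workspace and in a ball. -/
structure RequestsWithin (W : Set Plane) (c : Plane) (ρ : ℝ) (r : Requests) : Prop where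
  time_nonneg : ∀ j, 0 ≤ r.time j
  time_mono : Monotone r.time
  loc_mem : ∀ j, r.loc j ∈ W
  dist_loc_le : ∀ j, dist (r.loc j) c ≤ ρ

/-- The requests with labels in `L` that have not been visited up to time `t`. -/
def unvisited (r : Requests) (x : Motion m) (L : Set ℕ) (t : ℝ) : Set ℕ :=
  {k ∈ L | ∀ s ∈ visits r x k, t < s}

/-- The smallest distance between an agent and a target with label in `S`. -/
noncomputable def pairDist (r : Requests) (x : Motion m) (S : Set ℕ) (t : ℝ) : ℝ :=
  ⨅ p : S × Fin m, dist (x.pos p.2 t) (r.loc p.1)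

open Classical in
/-- An upper bound for the time needed to visit all targets with labels in `S`. -/
noncomputable def backlog (C : ℝ) (r : Requests) (x : Motion m) (S : Set ℕ) (t : ℝ) : ℝ :=
  -- The general formula would give `-C` on the empty set.
  if S = ∅ then 0 else C * (S.ncard - 1) + pairDist r x S t

theorem backlog_of_nonempty (C : ℝ) (r : Requests) (x : Motion m) {S : Set ℕ} (hS : S.Nonempty)
    (t : ℝ) : backlog C r x S t = C * (S.ncard - 1) + pairDist r x S t :=
  if_neg hS.ne_empty

theorem unvisited_subset (r : Requests) (x : Motion m) (L : Set ℕ) (t : ℝ) :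
    unvisited r x L t ⊆ L := fun _ h => h.1

theorem unvisited_antitone (r : Requests) (x : Motion m) (L : Set ℕ) :
    Antitone (unvisited r x L) :=
  fun _ _ hst _ hk => ⟨hk.1, fun u hu => hst.trans_lt (hk.2 u hu)⟩

theorem pairDist_nonneg (r : Requests) (x : Motion m) (S : Set ℕ) (t : ℝ) :
    0 ≤ pairDist r x S t := Real.iInf_nonneg fun _ => dist_nonneg

theorem pairDist_le {r : Requests} {x : Motion m} {S : Set ℕ} {t : ℝ} {k : ℕ}
    (hk : k ∈ S) (i : Fin m) : pairDist r x S t ≤ dist (x.pos i t) (r.loc k) :=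
  ciInf_le (f := fun p : S × Fin m => dist (x.pos p.2 t) (r.loc p.1))
    ⟨0, by rintro _ ⟨p, rfl⟩; exact dist_nonneg⟩ (⟨k, hk⟩, i)

theorem exists_eq_pairDist {r : Requests} {x : Motion m} {S : Set ℕ} (t : ℝ) (hS : S.Finite)
    (hne : S.Nonempty) :
    ∃ k ∈ S, ∃ i, dist (x.pos i t) (r.loc k) = pairDist r x S t := by
  have := hS.to_subtype
  have := hne.to_subtype
  have : Nonempty (Fin m) := ⟨x.server 0⟩
  obtain ⟨⟨⟨k, hk⟩, i⟩, h⟩ := exists_eq_ciInf_of_finite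
    (f := fun p : S × Fin m => dist (x.pos p.2 t) (r.loc p.1))
  exact ⟨k, hk, i, h⟩

theorem pairDist_anti {r : Requests} {x : Motion m} {S T : Set ℕ} (t : ℝ) (hS : S.Finite)
    (hne : S.Nonempty) (h : S ⊆ T) : pairDist r x T t ≤ pairDist r x S t := by
  obtain ⟨k, hk, i, hki⟩ := exists_eq_pairDist (r := r) (x := x) t hS hne
  exact hki ▸ pairDist_le (h hk) i

theorem lipschitzOnWith_pairDist {r : Requests} {x : Motion m} {S : Set ℕ} {s : Set ℝ}
    (hx : ∀ i, LipschitzOnWith 1 (x.pos i) s) (hS : S.Finite) (hne : S.Nonempty) :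
    LipschitzOnWith 1 (pairDist r x S) s := by
  refine LipschitzOnWith.of_le_add_mul 1 fun a ha b hb => ?_
  obtain ⟨k, hk, i, hki⟩ := exists_eq_pairDist (r := r) (x := x) b hS hne
  have h1 := (hx i).dist_le_mul a ha b hb
  rw [← hki]
  calc pairDist r x S a ≤ dist (x.pos i a) (r.loc k) := pairDist_le hk i
    _ ≤ _ := by linarith [dist_triangle (x.pos i a) (x.pos i b) (r.loc k)]

namespace IsTrajectory

variable {π : Policy} {W : Set Plane} {y₀ : Fin m → Plane} {r : Requests} {x : Motion m}
  {c : Plane} {ρ : ℝ}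

theorem ae_dynamics (hx : IsTrajectory π W y₀ r x) : ∀ᵐ t : ℝ, 0 ≤ t → ∀ i,
    ∃ q ∈ aim W r (fun k => x.pos k t) i (serviced r x i t) (r.loc '' demand r x t) π,
      HasDerivAt (x.pos i) (vers (q - x.pos i t)) t :=
  (ae_restrict_iff' measurableSet_Ici).1 hx.dynamics

theorem isClosed_visits (hx : IsTrajectory π W y₀ r x) (hr : RequestsWithin W c ρ r) (j : ℕ) :
    IsClosed (visits r x j) := by
  have : visits r x j = ⋃ i, Ici (r.time j) ∩ x.pos i ⁻¹' {r.loc j} := by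
    ext s; simp [visits]
  rw [this]
  refine isClosed_iUnion_of_finite fun i => ?_
  exact ((hx.speed i).continuousOn.mono
    (Ici_subset_Ici.2 (hr.time_nonneg j))).preimage_isClosed_of_isClosed isClosed_Ici
    isClosed_singleton

theorem exists_isLeast_visits (hx : IsTrajectory π W y₀ r x) (hr : RequestsWithin W c ρ r)
    {j : ℕ} {t : ℝ} (h : ∃ s ∈ visits r x j, s ≤ t) : ∃ s ≤ t, IsLeast (visits r x j) s := by
  obtain ⟨s, hs, hst⟩ := h
  have hbdd : BddBelow (visits r x j) := ⟨r.time j, fun u hu => hu.1⟩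
  exact ⟨_, (csInf_le hbdd hs).trans hst, (hx.isClosed_visits hr j).csInf_mem ⟨s, hs⟩ hbdd,
    fun u hu => csInf_le hbdd hu⟩

theorem setOf_time_lt_eq (hr : RequestsWithin W c ρ r) {j : ℕ} {t : ℝ}
    (ht : t ∈ Ioc (r.time j) (r.time (j + 1))) : {k | r.time k < t} = Iic j := by
  ext k
  simp only [mem_ofPred_eq, mem_Iic]
  constructor
  · intro hk
    by_contra! h
    exact absurd (ht.2.trans (hr.time_mono h)) (not_le.2 hk)
  · exact fun hk => (hr.time_mono hk).trans_lt ht.1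

/-- The interval is open on the left: at `r.time j` itself request `j` is not yet in `demand`,
whereas `unvisited` with labels `Iic j` may already contain it. -/
theorem demand_eq (hr : RequestsWithin W c ρ r) {j : ℕ} {t : ℝ}
    (ht : t ∈ Ioc (r.time j) (r.time (j + 1))) : demand r x t = unvisited r x (Iic j) t := by
  have := setOf_time_lt_eq hr ht
  ext k
  have hk : r.time k < t ↔ k ∈ Iic j := by rw [← this]; rfl
  simp only [demand, unvisited, mem_ofPred_eq, hk]

/-- The right side does not depend on `t`, so the Weber minimizers stay fixed while the agents
travel back. -/
theorem serviced_eq (hx : IsTrajectory π W y₀ r x) (hr : RequestsWithin W c ρ r) {j : ℕ} {t : ℝ}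
    (ht : t ∈ Ioc (r.time j) (r.time (j + 1))) (hd : demand r x t = ∅) (i : Fin m) :
    serviced r x i t = {k ∈ Iic j | x.server k = i} := by
  have := setOf_time_lt_eq hr ht
  ext k
  have hk : r.time k < t ↔ k ∈ Iic j := by rw [← this]; rfl
  simp only [serviced, mem_ofPred_eq, hk]
  refine ⟨fun h => ⟨h.1, h.2.1⟩, fun h => ⟨h.1, h.2, hx.exists_isLeast_visits hr ?_⟩⟩
  by_contra! hno
  have : k ∈ demand r x t := ⟨hk.2 h.1, hno⟩
  simp [hd] at this

/-- Every aim is a target, a Weber minimizer (in the hull of targets) or, before any service, the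
agent's own position; none of these leads out of the ball. Truncating the distance below at `ρ`
makes it a monotone quantity. -/
theorem dist_pos_le (hx : IsTrajectory π W y₀ r x) (hr : RequestsWithin W c ρ r)
    (hW : Convex ℝ W) (hy₀ : ∀ i, dist (y₀ i) c ≤ ρ) (i : Fin m) {t : ℝ} {J : ℕ} (ht0 : 0 ≤ t)
    (htJ : t ≤ r.time J) : dist (x.pos i t) c ≤ ρ := by
  have hlip : LipschitzOnWith 1 (fun s => max (dist (x.pos i s) c) ρ) (Icc 0 t) := by
    have h1 := lipschitzOnWith_dist_const ((hx.speed i).mono Icc_subset_Ici_self) c (s := Icc 0 t)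
    refine LipschitzOnWith.of_le_add_mul 1 fun a ha b hb => ?_
    have h2 := (abs_le.1 (h1.dist_le_mul a ha b hb)).2
    refine max_le ?_ ((le_max_right _ _).trans (le_add_of_nonneg_right (by positivity)))
    linarith [le_max_left (dist (x.pos i b) c) ρ]
  have hanti := antitoneOn_of_ae_hasDerivAt_nonpos hlip (by
    filter_upwards [hx.ae_dynamics] with s hs hm d hd
    obtain ⟨q, hq, hder⟩ := hs hm.1.le i
    rcases le_or_gt (dist (x.pos i s) c) ρ with h | h
    -- Here the truncated distance attains its global minimum `ρ`.
    · refine (IsLocalMin.hasDerivAt_eq_zero (Eventually.of_forall fun u => ?_) hd).le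
      simp only [max_eq_right h]
      exact le_max_right _ _
    · have hloc : (fun u => max (dist (x.pos i u) c) ρ) =ᶠ[𝓝 s] fun u => dist (x.pos i u) c := by
        have hcont : ContinuousAt (fun u => dist (x.pos i u) c) s :=
          hder.continuousAt.dist continuousAt_const
        filter_upwards [hcont.eventually (lt_mem_nhds h)] with u hu
        exact max_eq_left hu.le
      have hpos : 0 < dist (x.pos i s) c := by
        have : 0 ≤ ρ := dist_nonneg.trans (hy₀ i)
        linarith
      have hd' := (hasDerivAt_dist_const hder hpos).unique (hd.congr_of_eventuallyEq hloc.symm)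
      rw [← hd']
      have hqball : dist q c ≤ ρ ∨ q = x.pos i s := by
        rcases mem_or_mem_referencePoint_of_mem_aim hq with ⟨k, -, rfl⟩ | hq
        · exact Or.inl (hr.dist_loc_le k)
        · have hfin : (serviced r x i s).Finite := by
            refine (finite_Iio J).subset fun k hk => ?_
            by_contra hkJ
            have h1 := hr.time_mono (not_lt.1 hkJ)
            have h2 : r.time k < s := hk.1
            linarith [hm.2]
          rcases (serviced r x i s).eq_empty_or_nonempty with h0 | hne
          · right
            have h2 : q ∈ nearest (weberPoints W r (serviced r x i s)) (x.pos i s) := hq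
            rw [h0, weberPoints_empty] at h2
            have h3 := h2.2 _ (hx.mem i s hm.1.le)
            rw [dist_self] at h3
            exact (dist_le_zero.1 h3).symm
          · left
            have h2 : q ∈ weberPoints W r (serviced r x i s) := hq.1
            refine convexHull_min (t := Metric.closedBall c ρ) ?_ (convex_closedBall c ρ)
              (weberPoints_subset hW hr.loc_mem hfin hne h2)
            rintro _ ⟨k, -, rfl⟩
            exact hr.dist_loc_le k
      refine div_nonpos_of_nonpos_of_nonneg ?_ hpos.le
      rcases hqball with hqb | rfl
      · rw [vers, inner_smul_right]
        refine mul_nonpos_of_nonneg_of_nonpos (by positivity) ?_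
        rw [show q - x.pos i s = (q - c) - (x.pos i s - c) by abel, inner_sub_right,
          real_inner_self_eq_norm_sq]
        have h4 := real_inner_le_norm (x.pos i s - c) (q - c)
        rw [dist_eq_norm] at hqb h hpos
        nlinarith
      · simp [vers])
  have := hanti (left_mem_Icc.2 ht0) (right_mem_Icc.2 ht0) ht0
  simp only [hx.init] at this
  rw [max_eq_right (hy₀ i)] at this
  exact (le_max_left _ _).trans this

/-- While the queue does not change, the smallest distance between agents and outstanding targets
decreases at unit rate. -/
theorem pairDist_le_sub (hx : IsTrajectory π W y₀ r x) (hr : RequestsWithin W c ρ r) {j : ℕ}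
    {a b : ℝ} {S : Set ℕ} (haj : r.time j ≤ a) (hab : a ≤ b) (hbj : b ≤ r.time (j + 1))
    (hne : S.Nonempty) (hS : ∀ t ∈ Ico a b, unvisited r x (Iic j) t = S) :
    pairDist r x S b ≤ pairDist r x S a - (b - a) := by
  rcases hab.eq_or_lt with rfl | hlt
  · simp
  have hfin : S.Finite := by
    rw [← hS a ⟨le_rfl, hlt⟩]
    exact (finite_Iic j).subset (unvisited_subset _ _ _ _)
  have h0a : 0 ≤ a := (hr.time_nonneg j).trans haj
  have hlip : LipschitzOnWith 1 (pairDist r x S) (Icc a b) :=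
    lipschitzOnWith_pairDist (fun i => (hx.speed i).mono fun t ht => h0a.trans ht.1) hfin hne
  have := le_sub_of_ae_hasDerivAt_le (v := 1) hab hlip (by
    filter_upwards [hx.ae_dynamics] with t ht hm d hd
    have htd : demand r x t = S := by
      rw [demand_eq hr ⟨haj.trans_lt hm.1, hm.2.le.trans hbj⟩, hS t ⟨hm.1.le, hm.2⟩]
    obtain ⟨k, hk, i, hki⟩ := exists_eq_pairDist (r := r) (x := x) t hfin hne
    obtain ⟨q, hq, hder⟩ := ht (h0a.trans hm.1.le) i
    rw [htd] at hq
    obtain ⟨⟨k', hk', rfl⟩, hle⟩ := mem_and_dist_le_of_mem_aim hq (mem_image_of_mem _ hk)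
      (hr.loc_mem k) fun j => by
        rw [dist_comm, hki, dist_comm]; exact pairDist_le hk j
    -- The target aimed at is as close as the closest pair, so it also realizes the minimum, and the
    -- agent approaches it at unit speed.
    have heq : pairDist r x S t = dist (x.pos i t) (r.loc k') :=
      le_antisymm (pairDist_le hk' i) (hki ▸ hle)
    have hpos : 0 < dist (x.pos i t) (r.loc k') := by
      refine dist_pos.2 fun h => ?_
      rw [← htd] at hk'
      exact lt_irrefl t (hk'.2 t ⟨hk'.1.le, i, h⟩)
    exact (hasDerivAt_unique_of_le (f := fun s => dist (x.pos i s) (r.loc k'))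
      (fun s => pairDist_le hk' i) heq
      (hasDerivAt_dist_of_vers hder hpos) hd).le)
  linarith

theorem pairDist_le_two_mul (hx : IsTrajectory π W y₀ r x) (hr : RequestsWithin W c ρ r)
    (hW : Convex ℝ W) (hy₀ : ∀ i, dist (y₀ i) c ≤ ρ) {t : ℝ} {J : ℕ} (ht0 : 0 ≤ t)
    (htJ : t ≤ r.time J) {S : Set ℕ} (hne : S.Nonempty) : pairDist r x S t ≤ 2 * ρ := by
  obtain ⟨k, hk⟩ := hne
  refine (pairDist_le hk (x.server 0)).trans ?_
  linarith [dist_triangle_right (x.pos (x.server 0) t) (r.loc k) c, hr.dist_loc_le k,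
    hx.dist_pos_le hr hW hy₀ (x.server 0) ht0 htJ]

/-- Induction on the number of outstanding targets. Up to the first visit time only the pair
distance moves, at unit rate; at that time at least one target drops out, and the released `2ρ` pays
for the new pair distance. The queue must be non-empty at `b`, since the backlog stops falling at
zero. -/
theorem backlog_le_sub (hx : IsTrajectory π W y₀ r x) (hr : RequestsWithin W c ρ r)
    (hW : Convex ℝ W) (hy₀ : ∀ i, dist (y₀ i) c ≤ ρ) {j : ℕ} {a b : ℝ} (haj : r.time j ≤ a)
    (hab : a ≤ b) (hbj : b ≤ r.time (j + 1)) (hne : (unvisited r x (Iic j) b).Nonempty) :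
    backlog (2 * ρ) r x (unvisited r x (Iic j) b) b ≤
      backlog (2 * ρ) r x (unvisited r x (Iic j) a) a - (b - a) := by
  set U := unvisited r x (Iic j) with hU
  have hUfin : ∀ t, (U t).Finite := fun t => (finite_Iic j).subset (unvisited_subset _ _ _ _)
  have hanti : Antitone U := unvisited_antitone r x _
  induction hn : (U a).ncard using Nat.strong_induction_on generalizing a with
  | _ n ih =>
  have hnea : (U a).Nonempty := hne.mono (hanti hab)
  by_cases hUab : U b = U a
  · have hconst : ∀ t ∈ Ico a b, U t = U a := fun t ht =>
      (hanti ht.1).antisymm (hUab ▸ hanti ht.2.le)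
    have := hx.pairDist_le_sub hr haj hab hbj hnea hconst
    rw [hUab, backlog, if_neg hnea.ne_empty, backlog, if_neg hnea.ne_empty]
    linarith
  · obtain ⟨k, hka, hkb⟩ : ∃ k ∈ U a, k ∉ U b := by
      by_contra! h
      exact hUab ((hanti hab).antisymm h)
    have hcl : IsClosed (⋃ k ∈ U a, visits r x k) :=
      (hUfin a).isClosed_biUnion fun k _ => hx.isClosed_visits hr k
    set Z := ⋃ k ∈ U a, visits r x k with hZ
    have hZa : ∀ s ∈ Z, a < s := fun s hs => by
      obtain ⟨l, hl, hs⟩ := mem_iUnion₂.1 hs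
      exact hl.2 s hs
    have hbdd : BddBelow Z := ⟨a, fun s hs => (hZa s hs).le⟩
    obtain ⟨u, hu, hub⟩ : ∃ u ∈ visits r x k, u ≤ b := by
      by_contra! h
      exact hkb ⟨hka.1, h⟩
    have huZ : u ∈ Z := mem_iUnion₂.2 ⟨k, hka, hu⟩
    have hsZ : sInf Z ∈ Z := hcl.csInf_mem ⟨u, huZ⟩ hbdd
    set s := sInf Z with hs
    have hsa : a < s := hZa s hsZ
    have hsb : s ≤ b := (csInf_le hbdd huZ).trans hub
    have hconst : ∀ t ∈ Ico a s, U t = U a := fun t ht =>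
      (hanti ht.1).antisymm fun l hl => ⟨hl.1, fun v hv =>
        ht.2.trans_le (csInf_le hbdd (mem_iUnion₂.2 ⟨l, hl, hv⟩))⟩
    have h1 := hx.pairDist_le_sub hr haj hsa.le (hsb.trans hbj) hnea hconst
    have hssub : U s ⊂ U a := by
      refine (hanti hsa.le).ssubset_of_not_subset fun h => ?_
      obtain ⟨l, hl, hls⟩ := mem_iUnion₂.1 hsZ
      exact lt_irrefl s ((h hl).2 s hls)
    have hcard : (U s).ncard < (U a).ncard := ncard_lt_ncard hssub (hUfin a)
    have h2 := ih _ (hn ▸ hcard) (haj.trans hsa.le) hsb rfl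
    have hnes : (U s).Nonempty := hne.mono (hanti hsb)
    have h3 := hx.pairDist_le_two_mul hr hW hy₀
      (((hr.time_nonneg j).trans haj).trans hsa.le) (hsb.trans hbj) hnes
    rw [backlog_of_nonempty _ _ _ hnes] at h2
    rw [backlog_of_nonempty _ _ _ hnea]
    have h4 := pairDist_nonneg r x (U a) s
    have h5 : ((U s).ncard : ℝ) + 1 ≤ (U a).ncard := by exact_mod_cast hcard
    have hρ : 0 ≤ ρ := dist_nonneg.trans (hr.dist_loc_le 0)
    nlinarith

theorem backlog_nonneg (hρ : 0 ≤ ρ) {S : Set ℕ} (hS : S.Finite) (t : ℝ) :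
    0 ≤ backlog (2 * ρ) r x S t := by
  rw [backlog]
  split_ifs with h
  · exact le_rfl
  · have h1 : (1 : ℝ) ≤ S.ncard := by
      exact_mod_cast (ncard_pos hS).2 (nonempty_iff_ne_empty.2 h)
    have := pairDist_nonneg r x S t
    have := mul_nonneg (mul_nonneg zero_le_two hρ) (sub_nonneg.2 h1)
    linarith

/-- The new request raises the cardinality by at most one, and extra targets can only lower the pair
distance. If the queue was empty, the new pair distance itself is at most `2ρ`. -/
theorem backlog_succ_le (hx : IsTrajectory π W y₀ r x) (hr : RequestsWithin W c ρ r)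
    (hW : Convex ℝ W) (hy₀ : ∀ i, dist (y₀ i) c ≤ ρ) (j : ℕ) :
    backlog (2 * ρ) r x (unvisited r x (Iic (j + 1)) (r.time (j + 1))) (r.time (j + 1)) ≤
      backlog (2 * ρ) r x (unvisited r x (Iic j) (r.time (j + 1))) (r.time (j + 1)) + 2 * ρ := by
  set t := r.time (j + 1)
  set U := unvisited r x (Iic j) t with hU
  set V := unvisited r x (Iic (j + 1)) t with hV
  have hρ : 0 ≤ ρ := dist_nonneg.trans (hr.dist_loc_le 0)
  have hUfin : U.Finite := (finite_Iic j).subset (unvisited_subset _ _ _ _)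
  have hVfin : V.Finite := (finite_Iic (j + 1)).subset (unvisited_subset _ _ _ _)
  have hVU : V ⊆ insert (j + 1) U := fun k hk => by
    rcases Nat.lt_or_ge j k with h | h
    · exact Or.inl (le_antisymm hk.1 h)
    · exact Or.inr ⟨h, hk.2⟩
  have hUV : U ⊆ V := fun k hk => ⟨hk.1.trans j.le_succ, hk.2⟩
  have hcard : (V.ncard : ℝ) ≤ U.ncard + 1 := by
    exact_mod_cast (ncard_le_ncard hVU (hUfin.insert _)).trans (ncard_insert_le _ _)
  rcases U.eq_empty_or_nonempty with h0 | hne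
  · rcases V.eq_empty_or_nonempty with hV0 | hVne
    · rw [h0, hV0]
      simp [backlog, hρ]
    · have := hx.pairDist_le_two_mul hr hW hy₀ (hr.time_nonneg (j + 1)) le_rfl hVne
      rw [backlog, if_neg hVne.ne_empty, backlog, if_pos h0]
      rw [h0, ncard_empty, Nat.cast_zero, zero_add] at hcard
      nlinarith
  · have hVne : V.Nonempty := hne.mono hUV
    rw [backlog, if_neg hVne.ne_empty, backlog, if_neg hne.ne_empty]
    have := pairDist_anti (r := r) (x := x) t hUfin hne hUV
    nlinarith

/-- The solved workload recursion: `i` is the request that opened the current busy period, before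
which the queue was last found empty. -/
theorem exists_backlog_le (hx : IsTrajectory π W y₀ r x) (hr : RequestsWithin W c ρ r)
    (hW : Convex ℝ W) (hy₀ : ∀ i, dist (y₀ i) c ≤ ρ) (j : ℕ) :
    ∃ i ≤ j, backlog (2 * ρ) r x (unvisited r x (Iic j) (r.time j)) (r.time j) ≤
      (j - i + 1 : ℝ) * (2 * ρ) - (r.time j - r.time i) := by
  have hρ : 0 ≤ ρ := dist_nonneg.trans (hr.dist_loc_le 0)
  induction j with
  | zero =>
    refine ⟨0, le_rfl, ?_⟩
    rcases (unvisited r x (Iic 0) (r.time 0)).eq_empty_or_nonempty with h0 | hne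
    · rw [h0]; simp [backlog, hρ]
    · have h1 := hx.pairDist_le_two_mul hr hW hy₀ (hr.time_nonneg 0) le_rfl hne
      have h2 : ((unvisited r x (Iic 0) (r.time 0)).ncard : ℝ) ≤ 1 := by
        have := ncard_le_ncard (unvisited_subset r x (Iic 0) (r.time 0)) (finite_Iic 0)
        rw [show (Iic 0 : Set ℕ) = {0} by ext; simp, ncard_singleton] at this
        rw [show (Iic 0 : Set ℕ) = {0} by ext; simp]
        exact_mod_cast this
      rw [backlog, if_neg hne.ne_empty]
      nlinarith
  | succ j ih =>
    have hstep := hx.backlog_succ_le hr hW hy₀ j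
    rcases (unvisited r x (Iic j) (r.time (j + 1))).eq_empty_or_nonempty with h0 | hne
    · refine ⟨j + 1, le_rfl, ?_⟩
      conv_rhs at hstep => rw [backlog, if_pos h0]
      linarith
    · obtain ⟨i, hij, hi⟩ := ih
      refine ⟨i, hij.trans j.le_succ, ?_⟩
      have := hx.backlog_le_sub hr hW hy₀ le_rfl (hr.time_mono j.le_succ) le_rfl hne
      push_cast
      nlinarith

/-- Once the queue is empty, and as long as no new request is generated, the agents head for
their reference points and stay there. -/
theorem atReference_of_demand_empty (hx : IsTrajectory π W y₀ r x)
    (hr : RequestsWithin W c ρ r) (hW : Convex ℝ W) (hy₀ : ∀ i, dist (y₀ i) c ≤ ρ) {j : ℕ}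
    {s t : ℝ} (hs : r.time j < s) (hst : s + 2 * ρ ≤ t) (ht : t ≤ r.time (j + 1))
    (hU : unvisited r x (Iic j) s = ∅) : AllWaiting W r x t := by
  have hρ : 0 ≤ ρ := dist_nonneg.trans (hr.dist_loc_le 0)
  have hst' : s ≤ t := by linarith
  have hgap : ∀ u ∈ Icc s t, u ∈ Ioc (r.time j) (r.time (j + 1)) :=
    fun u hu => ⟨hs.trans_le hu.1, hu.2.trans ht⟩
  have hdem : ∀ u ∈ Icc s t, demand r x u = ∅ := fun u hu => by
    rw [demand_eq hr (hgap u hu)]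
    exact subset_eq_empty (unvisited_antitone r x _ hu.1) hU
  have hs0 : 0 ≤ s := (hr.time_nonneg j).trans hs.le
  have htmem := right_mem_Icc.2 hst'
  refine ⟨hdem t htmem, fun i => ?_⟩
  change x.pos i t ∈ nearest (weberPoints W r (serviced r x i t)) (x.pos i t)
  rw [mem_nearest_self, hx.serviced_eq hr (hgap t htmem) (hdem t htmem)]
  set B := {k ∈ Iic j | x.server k = i} with hB
  rcases B.eq_empty_or_nonempty with h0 | hne
  · rw [h0, weberPoints_empty]
    exact hx.mem i t (hs0.trans hst')
  have hBfin : B.Finite := (finite_Iic j).subset fun k hk => hk.1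
  have hcpt := isCompact_weberPoints hW hr.loc_mem hBfin hne
  have hMne := weberPoints_nonempty hW hr.loc_mem hBfin hne
  set M := weberPoints W r B with hM
  -- The distance to the whole set of minimizers is tracked, as the nearest minimizer may change
  -- along the way.
  have hlip : LipschitzOnWith 1 (fun u => Metric.infDist (x.pos i u) M) (Icc s t) := by
    have := (Metric.lipschitz_infDist_pt M).comp_lipschitzOnWith
      ((hx.speed i).mono fun u (hu : u ∈ Icc s t) => hs0.trans hu.1)
    rwa [one_mul] at this
  have hdecay := le_max_of_ae_hasDerivAt_le_neg_one hst' hlip (fun _ => Metric.infDist_nonneg) (by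
    filter_upwards [hx.ae_dynamics] with u hu hm hpos d hd
    have hum := Ioo_subset_Icc_self hm
    obtain ⟨q, hq, hder⟩ := hu (hs0.trans hm.1.le) i
    rw [hdem u hum, image_empty, aim_empty,
      hx.serviced_eq hr (hgap u hum) (hdem u hum)] at hq
    have hq' : q ∈ nearest M (x.pos i u) := hq
    have heq := infDist_eq_of_mem_nearest hq'
    exact (hasDerivAt_unique_of_le (fun v => Metric.infDist_le_dist_of_mem hq'.1) heq
      (hasDerivAt_dist_of_vers hder (heq ▸ hpos)) hd).le)
  have hsball := hx.dist_pos_le hr hW hy₀ i hs0 (hst'.trans ht)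
  have hinit : Metric.infDist (x.pos i s) M ≤ 2 * ρ := by
    obtain ⟨p, hp⟩ := hMne
    have hpball : dist p c ≤ ρ := by
      refine convexHull_min (t := Metric.closedBall c ρ) ?_ (convex_closedBall c ρ)
        (weberPoints_subset hW hr.loc_mem hBfin hne hp)
      rintro _ ⟨k, -, rfl⟩
      exact hr.dist_loc_le k
    refine (Metric.infDist_le_dist_of_mem hp).trans ?_
    linarith [dist_triangle_right (x.pos i s) p c]
  rw [max_eq_right (by linarith)] at hdecay
  exact (hcpt.isClosed.mem_iff_infDist_zero hMne).2 (le_antisymm hdecay Metric.infDist_nonneg)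

/-- All agents return before request `j + 1` if the preceding requests are not clustered. -/
theorem allReturn_of_gaps (hx : IsTrajectory π W y₀ r x) (hr : RequestsWithin W c ρ r)
    (hW : Convex ℝ W) (hy₀ : ∀ i, dist (y₀ i) c ≤ ρ) {j : ℕ}
    (hgap : ∀ i ≤ j, ((j + 1 : ℕ) - i : ℝ) * (4 * ρ) < r.time (j + 1) - r.time i) :
    AllReturn W r x j := by
  have hρ : 0 ≤ ρ := dist_nonneg.trans (hr.dist_loc_le 0)
  obtain ⟨i, hij, hi⟩ := hx.exists_backlog_le hr hW hy₀ j
  have hgi := hgap i hij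
  have hij' : (i : ℝ) ≤ j := by exact_mod_cast hij
  have hfin : (unvisited r x (Iic j) (r.time j)).Finite :=
    (finite_Iic j).subset (unvisited_subset _ _ _ _)
  have hb0 := backlog_nonneg (r := r) (x := x) hρ hfin (r.time j)
  set b := backlog (2 * ρ) r x (unvisited r x (Iic j) (r.time j)) (r.time j) with hb
  -- Each request is allotted `4ρ`: `2ρ` for its service and `2ρ` for returning, of which only one
  -- return is needed. The strict inequality leaves room for a time `s` after which the queue must
  -- be empty.
  have hlt : r.time j + b < r.time (j + 1) - 2 * ρ := by
    push_cast at hgi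
    nlinarith
  obtain ⟨s, hs1, hs2⟩ := exists_between hlt
  have hU : unvisited r x (Iic j) s = ∅ := by
    by_contra h
    have h1 := hx.backlog_le_sub hr hW hy₀ (a := r.time j) (b := s) le_rfl (by linarith)
      (by linarith) (nonempty_iff_ne_empty.2 h)
    have h2 := backlog_nonneg (r := r) (x := x) hρ
      ((finite_Iic j).subset (unvisited_subset r x (Iic j) s)) s
    linarith
  refine ⟨s + 2 * ρ, ⟨by linarith, by linarith⟩, fun t ht => ?_⟩
  exact hx.atReference_of_demand_empty hr hW hy₀ (by linarith) ht.1 ht.2 hU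

theorem allWaiting_zero (hx : IsTrajectory π W y₀ r x) (hr : RequestsWithin W c ρ r) :
    AllWaiting W r x (r.time 0) := by
  have h0 : ∀ k, ¬ r.time k < r.time 0 := fun k => not_lt.2 (hr.time_mono k.zero_le)
  refine ⟨eq_empty_of_forall_notMem fun k hk => h0 k hk.1, fun i => ?_⟩
  have hB : serviced r x i (r.time 0) = ∅ := eq_empty_of_forall_notMem fun k hk => h0 k hk.1
  change x.pos i _ ∈ nearest (weberPoints W r _) _
  rw [mem_nearest_self, hB, weberPoints_empty]
  exact hx.mem i _ (hr.time_nonneg 0)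

end IsTrajectory

theorem AllReturn.allWaiting_succ {W : Set Plane} {r : Requests} {x : Motion m} {j : ℕ}
    (h : AllReturn W r x j) : AllWaiting W r x (r.time (j + 1)) := by
  obtain ⟨s, hs, h⟩ := h
  exact h _ ⟨hs.2.le, le_rfl⟩

/-! ### Clusters of requests of a Poisson process -/

/-- Termwise comparison of the exponential tail, as `n! k!` divides `(n + k)!`. Times `exp (-x)`,
this is the Poisson tail bound. -/
theorem exp_sub_sum_range_le {x : ℝ} (hx : 0 ≤ x) (n : ℕ) :
    Real.exp x - ∑ k ∈ Finset.range n, x ^ k / (k.factorial : ℝ) ≤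
      x ^ n / (n.factorial : ℝ) * Real.exp x := by
  have hs := Real.summable_pow_div_factorial x
  have hexp : Real.exp x = ∑' k : ℕ, x ^ k / (k.factorial : ℝ) := by
    rw [Real.exp_eq_exp_ℝ, NormedSpace.exp_eq_tsum_div]
  have hsplit := hs.sum_add_tsum_nat_add n
  rw [← hexp] at hsplit
  rw [← hsplit, add_sub_cancel_left, hsplit, hexp, ← tsum_mul_left]
  refine ((summable_nat_add_iff n).2 hs).tsum_le_tsum (fun k => ?_) (hs.mul_left _)
  rw [div_mul_div_comm, ← pow_add, add_comm k n]
  refine div_le_div_of_nonneg_left (by positivity) (by positivity) ?_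
  exact_mod_cast Nat.le_of_dvd (Nat.factorial_pos _) (Nat.factorial_mul_factorial_dvd_factorial_add n k)

/-- All exponents are at least 2. This quadratic order is what survives division by the probability
of a non-empty cell. -/
theorem sum_range_pow_le {y : ℝ} (hy : 0 ≤ y) (hy2 : y ≤ 1 / 2) (J : ℕ) :
    ∑ i ∈ Finset.range J, y ^ (J + 1 - i) ≤ 2 * y ^ 2 := by
  induction J with
  | zero => simp; positivity
  | succ J ih =>
    rw [Finset.sum_range_succ, show J + 1 + 1 - J = 2 by omega]
    have : ∑ i ∈ Finset.range J, y ^ (J + 1 + 1 - i) =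
        y * ∑ i ∈ Finset.range J, y ^ (J + 1 - i) := by
      rw [Finset.mul_sum]
      refine Finset.sum_congr rfl fun i hi => ?_
      rw [← pow_succ', show J + 1 + 1 - i = J + 1 - i + 1 by
        have := Finset.mem_range.1 hi; omega]
    rw [this]
    nlinarith [mul_le_mul_of_nonneg_left ih hy, pow_nonneg hy 2]

/-- The number of requests generated in `[s, u)`. -/
noncomputable def Requests.arrivals (r : Requests) (s u : ℝ) : ℕ∞ :=
  r.count (Ico s u ×ˢ univ)

theorem Requests.arrivals_eq (r : Requests) (s u : ℝ) :
    r.arrivals s u = {j | r.time j ∈ Ico s u}.encard := by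
  simp [Requests.arrivals, Requests.count]

/-- The `J`-th request ends a cluster: some earlier request and it are too close in time for
a deterministic server with service time `C`. -/
def EndsCluster (C : ℝ) (r : Requests) (J : ℕ) : Prop :=
  ∃ i < J, r.time J - r.time i ≤ (J - i : ℝ) * C

/-- Rounding `r.time i` down to the grid, and replacing `i` by the number of requests before that
grid point, turns a condition on random times into one on counts in two disjoint fixed windows,
which are independent. The extra cell in `J + 1 - i` absorbs the rounding. -/
theorem EndsCluster.exists_arrivals {C : ℝ} (hC : 0 < C) {r : Requests}
    (h0 : ∀ j, 0 ≤ r.time j) (hmono : Monotone r.time) {J : ℕ} (h : EndsCluster C r J) :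
    ∃ i < J, ∃ n : ℕ, r.arrivals 0 (n * C) = i ∧
      ((J + 1 - i : ℕ) : ℕ∞) ≤ r.arrivals (n * C) (n * C + (J + 1 - i : ℕ) * C) := by
  obtain ⟨i, hiJ, hi⟩ := h
  set n := ⌊r.time i / C⌋₊ with hn
  have hn1 : n * C ≤ r.time i :=
    (le_div_iff₀ hC).1 (Nat.floor_le (div_nonneg (h0 i) hC.le))
  have hn2 : r.time i < (n + 1) * C := (div_lt_iff₀ hC).1 (Nat.lt_floor_add_one _)
  set A : Set ℕ := {j | r.time j ∈ Ico 0 (n * C)} with hA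
  have hAi : A ⊆ Iio i := fun k hk => by
    by_contra h
    exact absurd (hn1.trans (hmono (not_lt.1 h))) (not_le.2 hk.2)
  have hAfin : A.Finite := (finite_Iio i).subset hAi
  have hle : A.ncard ≤ i := by
    have := ncard_le_ncard hAi (finite_Iio i)
    simpa [ncard_eq_toFinset_card' (Iio i)] using this
  -- Otherwise labels `0, …, A.ncard` would all lie in `A`, one too many.
  have hnot : n * C ≤ r.time A.ncard := by
    by_contra! h
    have hsub : Iic A.ncard ⊆ A := fun k hk => ⟨h0 k, (hmono hk).trans_lt h⟩
    have := ncard_le_ncard hsub hAfin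
    simp [ncard_eq_toFinset_card' (Iic A.ncard)] at this
  refine ⟨A.ncard, hle.trans_lt hiJ, n, ?_, ?_⟩
  · rw [Requests.arrivals_eq, hAfin.cast_ncard_eq]
  · have hsub : Icc A.ncard J ⊆
        {j | r.time j ∈ Ico (n * C) (n * C + (J + 1 - A.ncard : ℕ) * C)} := by
      intro k hk
      refine ⟨hnot.trans (hmono hk.1), (hmono hk.2).trans_lt ?_⟩
      have hle' : (A.ncard : ℝ) ≤ i := by exact_mod_cast hle
      rw [Nat.cast_sub (by omega)]
      push_cast
      nlinarith
    rw [Requests.arrivals_eq]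
    refine le_trans (le_of_eq ?_) (encard_le_encard hsub)
    rw [← (finite_Icc A.ncard J).cast_ncard_eq, ncard_eq_toFinset_card' (Icc A.ncard J)]
    simp

/-! ### Poisson estimates: counts, tails, and the probability of a cluster. -/

namespace IsPoissonRequestProcess

variable {S₀ : Type*} [MeasurableSpace S₀] {μ : Measure S₀} {W : Set Plane} {φ : Plane → ℝ}
  {lam : ℝ} {R : S₀ → Requests}

theorem measurable_count (h : IsPoissonRequestProcess μ W φ lam R) {A : Set (ℝ × Plane)}
    (hA : MeasurableSet A) : Measurable fun ω => (R ω).count A := by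
  have hev : ∀ j, MeasurableSet {ω | ((R ω).time j, (R ω).loc j) ∈ A} := fun j =>
    ((h.measurable_time j).prodMk (h.measurable_loc j)) hA
  have hle : ∀ n : ℕ, MeasurableSet {ω | (n : ℕ∞) ≤ (R ω).count A} := fun n => by
    -- At least `n` requests fall in `A` iff some `n`-element set of labels does: a countable union.
    have : {ω | (n : ℕ∞) ≤ (R ω).count A} =
        ⋃ s : {s : Finset ℕ // s.card = n}, ⋂ j ∈ s.1,
          {ω | ((R ω).time j, (R ω).loc j) ∈ A} := by
      ext ω
      simp only [mem_ofPred_eq, mem_iUnion, mem_iInter, Requests.count]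
      constructor
      · intro hn
        obtain ⟨t, ht, htn⟩ := exists_subset_encard_eq hn
        have htfin : t.Finite := finite_of_encard_eq_coe htn
        refine ⟨⟨htfin.toFinset, ?_⟩, fun j hj => ht (by simpa using hj)⟩
        rw [← ncard_eq_toFinset_card t htfin, ncard_def, htn, ENat.toNat_natCast]
      · rintro ⟨⟨s, hs⟩, hsub⟩
        rw [← hs, ← encard_coe_eq_coe_finsetCard]
        exact encard_le_encard fun j hj => hsub j hj
    rw [this]
    exact MeasurableSet.iUnion fun s => s.1.measurableSet_biInter fun j _ => hev j
  refine measurable_to_countable' fun a => ?_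
  induction a using ENat.recTopCoe with
  | top =>
    have : (fun ω => (R ω).count A) ⁻¹' {⊤} = ⋂ n : ℕ, {ω | (n : ℕ∞) ≤ (R ω).count A} := by
      ext ω
      simp only [mem_preimage, mem_singleton_iff, mem_iInter, mem_ofPred_eq]
      exact ⟨fun h n => h ▸ le_top, fun h => ENat.eq_top_iff_forall_ge.2 h⟩
    rw [this]
    exact MeasurableSet.iInter hle
  | coe n =>
    have : (fun ω => (R ω).count A) ⁻¹' {(n : ℕ∞)} =
        {ω | (n : ℕ∞) ≤ (R ω).count A} \ {ω | ((n + 1 : ℕ) : ℕ∞) ≤ (R ω).count A} := by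
      ext ω
      simp only [mem_preimage, mem_singleton_iff, Set.mem_sdiff, mem_ofPred_eq, Nat.cast_add,
        Nat.cast_one, ENat.add_one_le_iff (ENat.natCast_ne_top n), not_lt]
      exact ⟨fun h => ⟨h.ge, h.le⟩, fun h => le_antisymm h.2 h.1⟩
    rw [this]
    exact (hle n).diff (hle (n + 1))

theorem measurable_arrivals (h : IsPoissonRequestProcess μ W φ lam R) (s u : ℝ) :
    Measurable fun ω => (R ω).arrivals s u :=
  h.measurable_count (measurableSet_Ico.prod MeasurableSet.univ)

theorem measure_arrivals_eq (h : IsPoissonRequestProcess μ W φ lam R) (hφ : ∫ q in W, φ q = 1)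
    {s t : ℝ} (hs : 0 ≤ s) (ht : 0 ≤ t) (k : ℕ) :
    μ {ω | (R ω).arrivals s (s + t) = k} =
      ENNReal.ofReal (Real.exp (-(lam * t)) * (lam * t) ^ k / (k.factorial : ℝ)) := by
  have := h.law s t univ k hs ht MeasurableSet.univ
  rwa [univ_inter, hφ, mul_one] at this

theorem measure_inter_arrivals (h : IsPoissonRequestProcess μ W φ lam R) {s : ℝ} (u : ℝ)
    (S T : Set ℕ∞) :
    μ ({ω | (R ω).arrivals 0 s ∈ S} ∩ {ω | (R ω).arrivals s u ∈ T}) =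
      μ {ω | (R ω).arrivals 0 s ∈ S} * μ {ω | (R ω).arrivals s u ∈ T} := by
  have hdisj : Disjoint (Ico 0 s ×ˢ (univ : Set Plane)) (Ico s u ×ˢ univ) :=
    Set.disjoint_left.2 fun p hp hq => absurd hp.1.2 (not_lt.2 hq.1.1)
  have hind := h.indep 2 ![Ico 0 s ×ˢ univ, Ico s u ×ˢ univ]
    (by
      intro k
      fin_cases k <;> exact measurableSet_Ico.prod MeasurableSet.univ)
    (by
      intro k l hkl
      fin_cases k <;> fin_cases l <;> first | exact absurd rfl hkl | exact hdisj | exact hdisj.symm)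
  exact (hind.indepFun (i := 0) (j := 1) (by decide)).measure_inter_preimage_eq_mul S T
    (MeasurableSet.of_discrete) (MeasurableSet.of_discrete)

variable [IsProbabilityMeasure μ]

theorem measure_le_arrivals_le (h : IsPoissonRequestProcess μ W φ lam R)
    (hφ : ∫ q in W, φ q = 1) (hlam : 0 < lam) {s t : ℝ} (hs : 0 ≤ s) (ht : 0 ≤ t) (M : ℕ) :
    μ {ω | (M : ℕ∞) ≤ (R ω).arrivals s (s + t)} ≤
      ENNReal.ofReal ((lam * t) ^ M / (M.factorial : ℝ)) := by
  set x := lam * t with hx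
  have hx0 : 0 ≤ x := mul_nonneg hlam.le ht
  have hmeas : ∀ k : ℕ, MeasurableSet {ω | (R ω).arrivals s (s + t) = k} := fun k =>
    h.measurable_arrivals s (s + t) (measurableSet_singleton (k : ℕ∞))
  -- Passing to the complement also covers an infinite count, on which `law` says nothing directly.
  have hcompl : {ω | (M : ℕ∞) ≤ (R ω).arrivals s (s + t)} =
      (⋃ k ∈ Finset.range M, {ω | (R ω).arrivals s (s + t) = k})ᶜ := by
    ext ω
    simp only [mem_ofPred_eq, mem_compl_iff, mem_iUnion, Finset.mem_range, not_exists]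
    constructor
    · intro hM k hk heq
      rw [heq] at hM
      exact absurd (by exact_mod_cast hM) (not_le.2 hk)
    · intro hk
      by_contra! hlt
      obtain ⟨l, hl⟩ := ENat.ne_top_iff_exists.1 hlt.ne_top
      rw [← hl] at hlt
      exact hk l (by exact_mod_cast hlt) hl.symm
  have hsum : μ (⋃ k ∈ Finset.range M, {ω | (R ω).arrivals s (s + t) = k}) =
      ENNReal.ofReal (∑ k ∈ Finset.range M, Real.exp (-x) * x ^ k / (k.factorial : ℝ)) := by
    rw [measure_biUnion_finset _ fun k _ => hmeas k]
    · rw [ENNReal.ofReal_sum_of_nonneg fun k _ => by positivity]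
      exact Finset.sum_congr rfl fun k _ => h.measure_arrivals_eq hφ hs ht k
    · intro k _ l _ hkl
      refine Set.disjoint_left.2 fun ω hk hl => hkl ?_
      have h1 : (R ω).arrivals s (s + t) = k := hk
      have h2 : (R ω).arrivals s (s + t) = l := hl
      exact_mod_cast h1.symm.trans h2
  rw [hcompl, prob_compl_eq_one_sub (Finset.measurableSet_biUnion _ fun k _ => hmeas k), hsum,
    ← ENNReal.ofReal_one, ← ENNReal.ofReal_sub _ (Finset.sum_nonneg fun k _ => by positivity)]
  refine ENNReal.ofReal_le_ofReal ?_
  have hle := mul_le_mul_of_nonneg_left (exp_sub_sum_range_le hx0 M) (Real.exp_pos (-x)).le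
  have hee : Real.exp (-x) * Real.exp x = 1 := by rw [← Real.exp_add]; simp
  simp_rw [mul_div_assoc, ← Finset.mul_sum]
  calc _ = Real.exp (-x) * (Real.exp x - ∑ k ∈ Finset.range M, x ^ k / (k.factorial : ℝ)) := by
        rw [mul_sub, hee]
    _ ≤ _ := hle
    _ = x ^ M / (M.factorial : ℝ) * (Real.exp (-x) * Real.exp x) := by ring
    _ = _ := by rw [hee, mul_one]

theorem measure_one_le_arrivals (h : IsPoissonRequestProcess μ W φ lam R)
    (hφ : ∫ q in W, φ q = 1) {s t : ℝ} (hs : 0 ≤ s) (ht : 0 ≤ t) :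
    μ {ω | 1 ≤ (R ω).arrivals s (s + t)} = ENNReal.ofReal (1 - Real.exp (-(lam * t))) := by
  have hcompl : {ω | 1 ≤ (R ω).arrivals s (s + t)} =
      {ω | (R ω).arrivals s (s + t) = (0 : ℕ)}ᶜ := by
    ext ω
    simp [Order.one_le_iff_ne_zero]
  rw [hcompl, prob_compl_eq_one_sub, h.measure_arrivals_eq hφ hs ht, ← ENNReal.ofReal_one,
    ← ENNReal.ofReal_sub _ (by positivity)]
  · simp
  · exact h.measurable_arrivals s (s + t) (measurableSet_singleton _)

/-- The expected number of cells at whose beginning exactly `i` requests have been generated is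
at most the inverse of the probability that a cell contains a request. -/
theorem tsum_measure_arrivals_mul_le (h : IsPoissonRequestProcess μ W φ lam R)
    (hφ : ∫ q in W, φ q = 1) {C : ℝ} (hC : 0 < C) (i : ℕ) :
    (∑' n : ℕ, μ {ω | (R ω).arrivals 0 (n * C) = i}) *
      ENNReal.ofReal (1 - Real.exp (-(lam * C))) ≤ 1 := by
  set E : ℕ → Set S₀ := fun n => {ω | (R ω).arrivals 0 (n * C) ∈ ({(i : ℕ∞)} : Set ℕ∞)} ∩
    {ω | (R ω).arrivals (n * C) (n * C + C) ∈ Ici (1 : ℕ∞)} with hE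
  have hEm : ∀ n, MeasurableSet (E n) := fun n =>
    (h.measurable_arrivals _ _ MeasurableSet.of_discrete).inter
      (h.measurable_arrivals _ _ MeasurableSet.of_discrete)
  -- A request in cell `n` pushes the count above `i` for all later cells.
  have hlt : ∀ n n' : ℕ, n < n' → Disjoint (E n) (E n') := fun n n' hnn' => by
    refine Set.disjoint_left.2 fun ω h1 h2 => ?_
    have e1 : (R ω).arrivals 0 (n * C) = i := h1.1
    have e2 : 1 ≤ (R ω).arrivals (n * C) (n * C + C) := h1.2
    have e3 : (R ω).arrivals 0 (n' * C) = i := h2.1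
    rw [Requests.arrivals_eq] at e1 e2 e3
    have hn' : (n : ℝ) * C + C ≤ n' * C := by
      have : (n : ℝ) + 1 ≤ n' := by exact_mod_cast hnn'
      nlinarith
    have hn0 : 0 ≤ (n : ℝ) * C := by positivity
    have hdisj : Disjoint {j | (R ω).time j ∈ Ico 0 (n * C)}
        {j | (R ω).time j ∈ Ico (n * C) (n * C + C)} :=
      Set.disjoint_left.2 fun j hj hj' => absurd hj.2 (not_lt.2 hj'.1)
    have hsub : {j | (R ω).time j ∈ Ico 0 (n * C)} ∪
        {j | (R ω).time j ∈ Ico (n * C) (n * C + C)} ⊆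
        {j | (R ω).time j ∈ Ico 0 (n' * C)} := by
      rintro j (hj | hj)
      · exact ⟨hj.1, by linarith [hj.2]⟩
      · exact ⟨hn0.trans hj.1, hj.2.trans_le hn'⟩
    have hle := encard_le_encard hsub
    rw [encard_union_eq hdisj, e1, e3] at hle
    have h3 : (i : ℕ∞) + 1 ≤ i := (add_le_add le_rfl e2).trans hle
    exact absurd (by exact_mod_cast h3) (Nat.not_succ_le_self i)
  have hdisj : Pairwise (Function.onFun Disjoint E) := fun n n' hnn' =>
    (lt_or_gt_of_ne hnn').elim (hlt n n') fun h => (hlt n' n h).symm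
  rw [← ENNReal.tsum_mul_right]
  calc _ = ∑' n, μ (E n) := by
        refine tsum_congr fun n => ?_
        rw [hE, h.measure_inter_arrivals,
          ← h.measure_one_le_arrivals hφ (s := n * C) (by positivity) hC.le]
        rfl
    _ = μ (⋃ n, E n) := (measure_iUnion hdisj hEm).symm
    _ ≤ 1 := prob_le_one

/-- A union bound over the number `i` of requests before the grid point and over the grid point,
with independence of past and future counts. The sum over grid points is at most `1 / q`, with `q ≥
a / 2`, whence `2 y ^ 2 / (a / 2)`. -/
theorem measure_endsCluster_le (h : IsPoissonRequestProcess μ W φ lam R)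
    (hφ : ∫ q in W, φ q = 1) (hlam : 0 < lam) {C : ℝ} (hC : 0 < C)
    (hsmall : Real.exp 1 * (lam * C) ≤ 1 / 2) (J : ℕ) :
    μ {ω | EndsCluster C (R ω) J} ≤ ENNReal.ofReal (4 * Real.exp 1 ^ 2 * (lam * C)) := by
  set a := lam * C with ha
  have ha0 : 0 < a := mul_pos hlam hC
  set y := Real.exp 1 * a with hy
  have hy0 : 0 ≤ y := by positivity
  set q := ENNReal.ofReal (1 - Real.exp (-a)) with hq
  -- Uses `M ^ M / M! ≤ exp M`.
  have htail : ∀ n M : ℕ, μ {ω | (M : ℕ∞) ≤ (R ω).arrivals (n * C) (n * C + M * C)} ≤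
      ENNReal.ofReal (y ^ M) := fun n M => by
    refine (h.measure_le_arrivals_le hφ hlam (by positivity) (by positivity) M).trans
      (ENNReal.ofReal_le_ofReal ?_)
    have hp := Real.pow_div_factorial_le_exp (M : ℝ) (Nat.cast_nonneg M) M
    calc (lam * (M * C)) ^ M / (M.factorial : ℝ) = (M : ℝ) ^ M / (M.factorial : ℝ) * a ^ M := by
          rw [show lam * (M * C) = M * a by rw [ha]; ring, mul_pow]; ring
      _ ≤ Real.exp M * a ^ M := by gcongr
      _ = y ^ M := by rw [hy, mul_pow (Real.exp 1), ← Real.exp_nat_mul, mul_one]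
  have hsub : {ω | EndsCluster C (R ω) J} ⊆ ⋃ i ∈ Finset.range J, ⋃ n : ℕ,
      ({ω | (R ω).arrivals 0 (n * C) ∈ ({(i : ℕ∞)} : Set ℕ∞)} ∩
        {ω | (R ω).arrivals (n * C) (n * C + (J + 1 - i : ℕ) * C) ∈
          Ici ((J + 1 - i : ℕ) : ℕ∞)}) := fun ω hω => by
    obtain ⟨i, hi, n, h1, h2⟩ :=
      EndsCluster.exists_arrivals hC (h.time_nonneg ω) (h.time_mono ω) hω
    exact mem_iUnion₂.2 ⟨i, Finset.mem_range.2 hi, mem_iUnion.2 ⟨n, h1, h2⟩⟩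
  have hbound : μ {ω | EndsCluster C (R ω) J} * q ≤ ENNReal.ofReal (2 * y ^ 2) := by
    calc μ {ω | EndsCluster C (R ω) J} * q
        ≤ (∑ i ∈ Finset.range J, ∑' n : ℕ, μ {ω | (R ω).arrivals 0 (n * C) = i} *
            ENNReal.ofReal (y ^ (J + 1 - i))) * q := by
          gcongr
          refine (measure_mono hsub).trans ((measure_biUnion_finset_le _ _).trans ?_)
          refine Finset.sum_le_sum fun i _ => (measure_iUnion_le _).trans ?_
          refine ENNReal.tsum_le_tsum fun n => ?_
          rw [h.measure_inter_arrivals]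
          exact mul_le_mul' le_rfl (htail n _)
      _ = ∑ i ∈ Finset.range J, ((∑' n : ℕ, μ {ω | (R ω).arrivals 0 (n * C) = i}) * q) *
            ENNReal.ofReal (y ^ (J + 1 - i)) := by
          rw [Finset.sum_mul]
          refine Finset.sum_congr rfl fun i _ => ?_
          rw [ENNReal.tsum_mul_right, mul_right_comm]
      _ ≤ ∑ i ∈ Finset.range J, ENNReal.ofReal (y ^ (J + 1 - i)) := by
          refine Finset.sum_le_sum fun i _ => ?_
          exact mul_le_of_le_one_left' (h.tsum_measure_arrivals_mul_le hφ hC i)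
      _ = ENNReal.ofReal (∑ i ∈ Finset.range J, y ^ (J + 1 - i)) :=
          (ENNReal.ofReal_sum_of_nonneg fun i _ => by positivity).symm
      _ ≤ ENNReal.ofReal (2 * y ^ 2) := ENNReal.ofReal_le_ofReal (sum_range_pow_le hy0 hsmall J)
  have ha1 : a ≤ 1 := by nlinarith [Real.add_one_le_exp (1 : ℝ)]
  have hqa : a / 2 ≤ 1 - Real.exp (-a) := by
    have h1 := Real.add_one_le_exp a
    have h2 : Real.exp (-a) * Real.exp a = 1 := by rw [← Real.exp_add]; simp
    nlinarith [Real.exp_pos (-a)]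
  have hb2 : μ {ω | EndsCluster C (R ω) J} * ENNReal.ofReal (a / 2) ≤
      ENNReal.ofReal (2 * y ^ 2) :=
    (mul_le_mul' le_rfl (ENNReal.ofReal_le_ofReal hqa)).trans hbound
  rw [← ENNReal.le_div_iff_mul_le (Or.inl (by simpa using ha0)) (Or.inl ENNReal.ofReal_ne_top),
    ← ENNReal.ofReal_div_of_pos (by positivity)] at hb2
  refine hb2.trans (le_of_eq ?_)
  congr 1
  rw [hy]
  field_simp
  ring

/-- The count in `[0, n) × S` is Poisson with mean zero for every `n`, and these windows exhaust
time. -/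
theorem measure_exists_loc_mem_eq_zero (h : IsPoissonRequestProcess μ W φ lam R) {S : Set Plane}
    (hS : MeasurableSet S) (hφS : ∫ q in S ∩ W, φ q = 0) :
    μ {ω | ∃ j, (R ω).loc j ∈ S} = 0 := by
  have hzero : ∀ n : ℕ, μ {ω | (R ω).count (Ico 0 (0 + (n : ℝ)) ×ˢ S) = (0 : ℕ)}ᶜ = 0 :=
    fun n => by
      rw [prob_compl_eq_zero_iff]
      · rw [h.law 0 n S 0 le_rfl n.cast_nonneg hS, hφS]
        simp
      · exact h.measurable_count (measurableSet_Ico.prod hS) (measurableSet_singleton _)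
  refine measure_mono_null ?_ (measure_iUnion_null hzero)
  rintro ω ⟨j, hj⟩
  obtain ⟨n, hn⟩ := exists_nat_gt ((R ω).time j)
  refine mem_iUnion.2 ⟨n, fun hc => ?_⟩
  have hc' : {k | ((R ω).time k, (R ω).loc k) ∈ Ico 0 (0 + (n : ℝ)) ×ˢ S}.encard = 0 := by
    simpa [Requests.count] using hc
  rw [encard_eq_zero] at hc'
  exact (eq_empty_iff_forall_notMem.1 hc' j) ⟨⟨h.time_nonneg ω j, by simpa using hn⟩, hj⟩

end IsPoissonRequestProcess

/-! ### Combining the deterministic criterion with the cluster estimate. -/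

variable {W : Set Plane} {π : Policy} {y₀ : Fin m → Plane} {r : Requests} {x : Motion m}
  {c : Plane} {ρ : ℝ}

theorem IsTrajectory.allReturn_of_not_endsCluster (hx : IsTrajectory π W y₀ r x)
    (hr : RequestsWithin W c ρ r) (hW : Convex ℝ W) (hy₀ : ∀ i, dist (y₀ i) c ≤ ρ) {j : ℕ}
    (h : ¬ EndsCluster (4 * ρ) r (j + 1)) : AllReturn W r x j := by
  refine hx.allReturn_of_gaps hr hW hy₀ fun i hi => ?_
  by_contra! hle
  exact h ⟨i, Nat.lt_succ_of_le hi, hle⟩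

theorem IsTrajectory.allWaiting_of_not_endsCluster (hx : IsTrajectory π W y₀ r x)
    (hr : RequestsWithin W c ρ r) (hW : Convex ℝ W) (hy₀ : ∀ i, dist (y₀ i) c ≤ ρ) {j : ℕ}
    (h : ¬ EndsCluster (4 * ρ) r j) : AllWaiting W r x (r.time j) := by
  cases j with
  | zero => exact hx.allWaiting_zero hr
  | succ j => exact (hx.allReturn_of_not_endsCluster hr hW hy₀ h).allWaiting_succ

theorem exists_closedBall_of_isBounded {Q : Set Plane} (hQ : Bornology.IsBounded Q)
    (y₀ : Fin m → Plane) :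
    ∃ ρ : ℝ, 0 < ρ ∧ Q ⊆ Metric.closedBall 0 ρ ∧ ∀ i, dist (y₀ i) 0 ≤ ρ := by
  obtain ⟨ρ, hρ⟩ := (hQ.union (finite_range y₀).isBounded).subset_closedBall (0 : Plane)
  have hsub : Metric.closedBall (0 : Plane) ρ ⊆ Metric.closedBall 0 (max ρ 1) :=
    Metric.closedBall_subset_closedBall (le_max_left _ _)
  -- The maximum with 1 makes the grid mesh `4ρ` positive.
  exact ⟨max ρ 1, lt_max_of_lt_right one_pos, fun q hq => hsub (hρ (Or.inl hq)),
    fun i => hsub (hρ (Or.inr (mem_range_self i)))⟩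

section Probability

variable {S₀ : Type*} [MeasurableSpace S₀] {μ : Measure S₀}
  {φ : Plane → ℝ} {lam : ℝ} {R : S₀ → Requests}

/-- The sets `E K` increase, so their union has measure `⨆ K, μ (E K)`, and `E K` lies in the
cluster event of the single index `K + 1`. No independence between indices is needed, and the
trajectory event itself need not be measurable. -/
theorem measure_exists_not_frequently_allReturn_le (h : IsPoissonRequestProcess μ W φ lam R)
    (hW : Convex ℝ W) (hy₀ : ∀ i, dist (y₀ i) c ≤ ρ) {ε : ENNReal}
    (hloc : μ {ω | ∃ j, (R ω).loc j ∈ (Metric.closedBall c ρ)ᶜ} = 0)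
    (hε : ∀ J, μ {ω | EndsCluster (4 * ρ) (R ω) J} ≤ ε) :
    μ {ω | ∃ x : Motion m, IsTrajectory π W y₀ (R ω) x ∧
      ¬ ∃ᶠ j in atTop, AllReturn W (R ω) x j} ≤ ε := by
  set Z := {ω | ∃ j, (R ω).loc j ∈ (Metric.closedBall c ρ)ᶜ}
  set E : ℕ → Set S₀ := fun K => {ω | ∀ j ≥ K, EndsCluster (4 * ρ) (R ω) (j + 1)}
  have hmono : Monotone E := fun K K' hK ω hω j hj => hω j (hK.trans hj)
  have hsub : {ω | ∃ x : Motion m, IsTrajectory π W y₀ (R ω) x ∧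
      ¬ ∃ᶠ j in atTop, AllReturn W (R ω) x j} ⊆ Z ∪ ⋃ K, E K := by
    rintro ω ⟨x, hx, hfr⟩
    by_cases hZ : ω ∈ Z
    · exact Or.inl hZ
    have hr : RequestsWithin W c ρ (R ω) := ⟨h.time_nonneg ω, h.time_mono ω, h.loc_mem ω,
      fun j => not_not.1 fun hj => hZ ⟨j, hj⟩⟩
    obtain ⟨K, hK⟩ := eventually_atTop.1 (not_frequently.1 hfr)
    refine Or.inr (mem_iUnion.2 ⟨K, fun j hj => ?_⟩)
    by_contra hcl
    exact hK j hj (hx.allReturn_of_not_endsCluster hr hW hy₀ hcl)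
  calc _ ≤ μ Z + μ (⋃ K, E K) := (measure_mono hsub).trans (measure_union_le _ _)
    _ = ⨆ K, μ (E K) := by rw [hloc, zero_add, hmono.measure_iUnion]
    _ ≤ ε := iSup_le fun K => (measure_mono fun ω (hω : ω ∈ E K) => hω K le_rfl).trans
        (hε (K + 1))

theorem measure_exists_not_allWaiting_le (h : IsPoissonRequestProcess μ W φ lam R)
    (hW : Convex ℝ W) (hy₀ : ∀ i, dist (y₀ i) c ≤ ρ) {ε : ENNReal}
    (hloc : μ {ω | ∃ j, (R ω).loc j ∈ (Metric.closedBall c ρ)ᶜ} = 0)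
    (hε : ∀ J, μ {ω | EndsCluster (4 * ρ) (R ω) J} ≤ ε) (k N : ℕ) :
    μ {ω | ∃ x : Motion m, IsTrajectory π W y₀ (R ω) x ∧
      ∃ j ∈ Set.Ico k (k + N), ¬ AllWaiting W (R ω) x ((R ω).time j)} ≤ N * ε := by
  set Z := {ω | ∃ j, (R ω).loc j ∈ (Metric.closedBall c ρ)ᶜ}
  have hsub : {ω | ∃ x : Motion m, IsTrajectory π W y₀ (R ω) x ∧
      ∃ j ∈ Set.Ico k (k + N), ¬ AllWaiting W (R ω) x ((R ω).time j)} ⊆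
      Z ∪ ⋃ j ∈ Finset.Ico k (k + N), {ω | EndsCluster (4 * ρ) (R ω) j} := by
    rintro ω ⟨x, hx, j, hj, hnot⟩
    by_cases hZ : ω ∈ Z
    · exact Or.inl hZ
    have hr : RequestsWithin W c ρ (R ω) := ⟨h.time_nonneg ω, h.time_mono ω, h.loc_mem ω,
      fun j => not_not.1 fun hj => hZ ⟨j, hj⟩⟩
    refine Or.inr (mem_iUnion₂.2 ⟨j, Finset.mem_Ico.2 hj, ?_⟩)
    by_contra hcl
    exact hnot (hx.allWaiting_of_not_endsCluster hr hW hy₀ hcl)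
  calc _ ≤ μ Z + μ (⋃ j ∈ Finset.Ico k (k + N), {ω | EndsCluster (4 * ρ) (R ω) j}) :=
        (measure_mono hsub).trans (measure_union_le _ _)
    _ ≤ ∑ j ∈ Finset.Ico k (k + N), μ {ω | EndsCluster (4 * ρ) (R ω) j} := by
        rw [hloc, zero_add]; exact measure_biUnion_finset_le _ _
    _ ≤ ∑ _j ∈ Finset.Ico k (k + N), ε := Finset.sum_le_sum fun j _ => hε j
    _ = N * ε := by simp

end Probability

end LightLoad
open LightLoad in
theorem mainTheorem9
    -- the workspace, the spatial density and its support
    (W Q : Set Plane) (φ : Plane → ℝ)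
    (hW : Convex ℝ W) (hW' : (interior W).Nonempty)
    (hφ : ∀ q ∈ W, 0 ≤ φ q) (hφ1 : ∫ q in W, φ q = 1)
    (hQW : Q ⊆ W) (hQ : ∀ q ∈ W, 0 < φ q ↔ q ∈ Q)
    (hQc : Convex ℝ Q) (hQb : Bornology.IsBounded Q)
    -- the agents, their initial positions and their policy
    (m : ℕ) (hm : 1 ≤ m) (y₀ : Fin m → Plane) (hy₀ : ∀ i, y₀ i ∈ W) (π : Policy)
    -- for every intensity, a Poisson process of service requests
    (S₀ : ℝ → Type*) [∀ lam, MeasurableSpace (S₀ lam)]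
    (P : ∀ lam, Measure (S₀ lam)) [∀ lam, IsProbabilityMeasure (P lam)]
    (R : ∀ lam, S₀ lam → Requests)
    (hR : ∀ lam, 0 < lam → IsPoissonRequestProcess (P lam) W φ lam (R lam)) :
    -- the probability that some trajectory of the agents does not have all of them
    -- return infinitely often before the next request tends to zero
    Tendsto (fun lam => P lam {ω | ∃ x : Motion m, IsTrajectory π W y₀ (R lam ω) x ∧
        ¬ ∃ᶠ j in atTop, AllReturn W (R lam ω) x j}) (𝓝[>] 0) (𝓝 0) ∧
    -- in every block of `N` successive requests, with high probability uniformly in the position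
    -- `k` of the block, each is generated with all agents waiting and an empty queue
    (∀ N : ℕ, Tendsto (fun lam => ⨆ k : ℕ,
        P lam {ω | ∃ x : Motion m, IsTrajectory π W y₀ (R lam ω) x ∧
          ∃ j ∈ Set.Ico k (k + N), ¬ AllWaiting W (R lam ω) x ((R lam ω).time j)})
      (𝓝[>] 0) (𝓝 0)) := by
  obtain ⟨ρ, hρ, hQρ, hyρ⟩ := exists_closedBall_of_isBounded hQb y₀
  have hloc : ∀ lam, 0 < lam →
      P lam {ω | ∃ j, (R lam ω).loc j ∈ (Metric.closedBall (0 : Plane) ρ)ᶜ} = 0 :=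
    fun lam hlam => (hR lam hlam).measure_exists_loc_mem_eq_zero
      Metric.isClosed_closedBall.measurableSet.compl
      -- Outside the ball, hence outside `Q`, the density vanishes on `W`.
      (setIntegral_eq_zero_of_forall_eq_zero fun q hq => le_antisymm
        (not_lt.1 fun hpos => hq.1 (hQρ ((hQ q hq.2).1 hpos))) (hφ q hq.2))
  set ε : ℝ → ENNReal := fun lam =>
    ENNReal.ofReal (4 * Real.exp 1 ^ 2 * (lam * (4 * ρ))) with hε
  have hε0 : Tendsto ε (𝓝[>] 0) (𝓝 0) := by
    have hcont : Continuous fun lam : ℝ => 4 * Real.exp 1 ^ 2 * (lam * (4 * ρ)) := by fun_prop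
    have := (ENNReal.continuous_ofReal.comp hcont).tendsto 0
    simp only [Function.comp_apply, zero_mul, mul_zero, ENNReal.ofReal_zero] at this
    exact this.mono_left nhdsWithin_le_nhds
  have hsmall : ∀ᶠ lam in 𝓝[>] (0 : ℝ), 0 < lam ∧ Real.exp 1 * (lam * (4 * ρ)) ≤ 1 / 2 := by
    have hcont : Continuous fun lam : ℝ => Real.exp 1 * (lam * (4 * ρ)) := by fun_prop
    have h0 : ∀ᶠ lam in 𝓝 (0 : ℝ), Real.exp 1 * (lam * (4 * ρ)) < 1 / 2 :=
      hcont.continuousAt.eventually (gt_mem_nhds (by norm_num))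
    filter_upwards [h0.filter_mono nhdsWithin_le_nhds, self_mem_nhdsWithin] with lam h1 h2
    exact ⟨h2, h1.le⟩
  have hbound : ∀ᶠ lam in 𝓝[>] (0 : ℝ), 0 < lam ∧
      ∀ J, P lam {ω | EndsCluster (4 * ρ) (R lam ω) J} ≤ ε lam := by
    filter_upwards [hsmall] with lam hlam
    exact ⟨hlam.1, fun J => (hR lam hlam.1).measure_endsCluster_le hφ1 hlam.1
      (by positivity) hlam.2 J⟩
  refine ⟨?_, fun N => ?_⟩
  · refine tendsto_of_tendsto_of_tendsto_of_le_of_le' tendsto_const_nhds hε0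
      (Eventually.of_forall fun _ => zero_le) ?_
    filter_upwards [hbound] with lam hlam
    exact measure_exists_not_frequently_allReturn_le (hR lam hlam.1) hW hyρ
      (hloc lam hlam.1) hlam.2
  · have hNε : Tendsto (fun lam => (N : ENNReal) * ε lam) (𝓝[>] 0) (𝓝 0) := by
      simpa using ENNReal.Tendsto.const_mul hε0 (Or.inr (ENNReal.natCast_ne_top N))
    refine tendsto_of_tendsto_of_tendsto_of_le_of_le' tendsto_const_nhds hNε
      (Eventually.of_forall fun _ => zero_le) ?_
    filter_upwards [hbound] with lam hlam
    exact iSup_le fun k => measure_exists_not_allWaiting_le (hR lam hlam.1) hW hyρ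
      (hloc lam hlam.1) hlam.2 k N
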